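/- Theorem 3.1. Multigraphs are finite and may have parallel edges but no loops. A $2$-bisection of a multigraph $G$ is a partition $(B,W)$ of $V(G)$ with $|B|=|W|$ such that every connected component of the induced subgraphs $G[B]$ and $G[W]$ has at most two vertices; an edge is monochromatic if both of its ends lie in the same part, and $\varepsilon(B,W)$ denotes the number of monochromatic edges (parallel edges are counted separately). A multigraph is claw-free if it has no induced subgraph isomorphic to $K_{1,3}$, and cubic if every vertex is incident with exactly three edges. A diamond of $G$ is an induced subgraph isomorphic to $K_4$ minus an edge. A digon of $G$ is a pair of distinct vertices that are joined by at least two parallel edges and have no common neighbour (so the two vertices of the multiple edge of a trumpet, i.e. of a triangle with a multiple edge on one of its sides, do not form a digon, while the two vertices of the cubic multigraph with two vertices and three parallel edges form one digon). Let $G$ be a connected claw-free cubic multigraph that is not isomorphic to $K_4$, let $k$ be the number of diamonds of $G$ and let $p$ be the number of digons of $G$. Then $G$ has a $2$-bisection $(\bar B,\bar W)$ such that $$\varepsilon(\bar B,\bar W)=\begin{cases}\dfrac{|V(G)|-k-2p}{3} & \text{if } k \text{ is even},\\[2mm] \dfrac{|V(G)|-k-2p}{3}+1 & \text{if } k \text{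 is odd}.\end{cases}$$ Moreover, $\varepsilon(\bar B,\bar W)\le \varepsilon(B,W)$ for every $2$-bisection $(B,W)$ of $G$. -/

import Mathlib

open scoped Graph

namespace Graph

variable {α β ι : Type*}

/-- Every vertex of the loopless multigraph `G` is incident with exactly three edges, parallel
edges being counted separately. (For loopless graphs this is the degree.) -/
def IsCubic (G : Graph α β) : Prop :=
  ∀ x ∈ V(G), (G.incidenceSet x).encard = 3

/-- The connected component of the vertex `x` in `G`, as a set of vertices. -/
def componentOf (G : Graph α β) (x : α) : Set α :=
  {y | y ∈ V(G) ∧ Relation.ReflTransGen G.Adj x y}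

/-- `G` is non-empty and any two of its vertices are joined by a walk. -/
def IsConnectedGraph (G : Graph α β) : Prop :=
  V(G).Nonempty ∧ ∀ x ∈ V(G), ∀ y ∈ V(G), Relation.ReflTransGen G.Adj x y

/-- The number of (parallel) edges joining `x` and `y`. -/
noncomputable def multiplicity (G : Graph α β) (x y : α) : ℕ∞ :=
  {e | G.IsLink e x y}.encard

/-- The subgraph of the multigraph `G` induced by the set of vertices `S` is isomorphic to the
simple graph `H`: a bijection from the vertices of `H` onto `S` carries the number of edges
between any two vertices in `H` (one or zero) to the number of edges between them in `G`. -/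
def InducesCopy (G : Graph α β) (S : Set α) (H : SimpleGraph ι) : Prop :=
  S ⊆ V(G) ∧ ∃ f : ι → α, Function.Injective f ∧ Set.range f = S ∧
    ∀ i j, (H.Adj i j → G.multiplicity (f i) (f j) = 1) ∧
      (¬ H.Adj i j → G.multiplicity (f i) (f j) = 0)

/-- No induced subgraph is a claw `K_{1,3}`. -/
def IsClawFree (G : Graph α β) : Prop :=
  ∀ S : Set α, ¬ G.InducesCopy S (completeBipartiteGraph (Fin 1) (Fin 3))

/-- `G` is isomorphic to the complete graph `K_4`. -/
def IsK4 (G : Graph α β) : Prop :=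
  G.InducesCopy V(G) (⊤ : SimpleGraph (Fin 4))

/-- `S` is the vertex set of a diamond: it induces a copy of `K_4` minus an edge. -/
def IsDiamond (G : Graph α β) (S : Set α) : Prop :=
  G.InducesCopy S ((⊤ : SimpleGraph (Fin 4)).deleteEdges {s(0, 1)})

/-- `S` is the vertex set of a trumpet: a triangle with a multiple edge on one of its sides. -/
def IsTrumpet (G : Graph α β) (S : Set α) : Prop :=
  ∃ x y z, x ≠ y ∧ x ≠ z ∧ y ≠ z ∧ S = {x, y, z} ∧
    2 ≤ G.multiplicity x y ∧ G.Adj x z ∧ G.Adj y z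

/-- `S` is the vertex set of a digon: two vertices joined by parallel edges that are not the
multiple edge of a trumpet. -/
def IsDigon (G : Graph α β) (S : Set α) : Prop :=
  (∃ x y, x ≠ y ∧ S = {x, y} ∧ 2 ≤ G.multiplicity x y) ∧
    ∀ T : Set α, G.IsTrumpet T → ¬ S ⊆ T

/-- The number of diamonds of `G`. -/
noncomputable def numDiamonds (G : Graph α β) : ℕ :=
  {S : Set α | G.IsDiamond S}.ncard

/-- The number of digons of `G`. -/
noncomputable def numDigons (G : Graph α β) : ℕ :=
  {S : Set α | G.IsDigon S}.ncard

/-- `(B, W)` is a partition of the vertex set of `G` into two parts of the same cardinality. -/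
structure IsBisection (G : Graph α β) (B W : Set α) : Prop where
  union_eq : B ∪ W = V(G)
  disjoint : Disjoint B W
  encard_eq : B.encard = W.encard

/-- `(B, W)` is an `m`-bisection of `G`: a bisection such that every connected component of
`G[B]` and of `G[W]` has at most `m` vertices. -/
structure IsKBisection (G : Graph α β) (m : ℕ) (B W : Set α) : Prop
    extends G.IsBisection B W where
  component_left : ∀ x ∈ B, ((G.induce B).componentOf x).encard ≤ m
  component_right : ∀ x ∈ W, ((G.induce W).componentOf x).encard ≤ m

/-- The number of monochromatic edges of `(B, W)`, i.e. of edges with both ends in the same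
part. -/
noncomputable def numMono (G : Graph α β) (B W : Set α) : ℕ :=
  {e | ∃ x y, G.IsLink e x y ∧ ((x ∈ B ∧ y ∈ B) ∨ (x ∈ W ∧ y ∈ W))}.ncard

end Graph

/-!
# Optimal 2-bisections of claw-free cubic multigraphs

In a claw-free cubic multigraph every vertex lies in a triangle or on a multiple edge. Following
only such edges splits the vertex set into *units*: digons, diamonds, and triangles that are not
contained in a diamond (with or without a double side); this uses that the graph is not `K_4`. So
`|V| = 2p + 3t + 4k`, where `t` is the number of the triangles, and the number
`(|V| - k - 2p) / 3` is `t + k`.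

*Lower bound.* Two vertices of a triangle have the same colour, so each triangle and each diamond
contains a monochromatic edge, and there are at least `t + k` of them. Counting the edges between
the two parts from either side shows that a bisection has as many edges inside `B` as inside `W`.
Hence the number of monochromatic edges is even. As `|V|` is even, so is `t`, and one more edge is
needed when `k` is odd (`IsCubicWeight.exists_class_edges`, `IsCubicWeight.le_monoSum`).

*Construction.* The edges between units form a perfect matching on the *ports*, which are all
vertices but the centres of the diamonds; on the double side of a trumpet, one of the two parallel
edges is put into this matching. All matching edges shall be bichromatic. The two ports of a digon
shall be different and those of a diamond equal, except for one diamond if `k` is odd; the centres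
of the diamond can then be coloured such that it is balanced and has one monochromatic edge (two for
the exceptional diamond). A triangle shall not be monochromatic. Such constraints on pairs of
vertices are met by *splicing*: a pair `a, b` with a prescribed relation that is not matched to each
other is removed, and the partners of `a` and `b` are matched instead, with the appropriate sign. In
a triangle, two vertices that are not matched to each other can always be found. When only a
matching is left, the sign of each pair is free, and the sum of the colours can be kept between
`-2` and `2` (`IsSignedMatching.exists_coloring_two`). Splicing can only get stuck when digons and
diamonds close up to a ring. By connectivity this ring is the whole graph, and the last constraint
follows from the others by parity (`IsCubicWeight.exists_port_coloring`). In the end the number of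
monochromatic edges is even, so the sum of the colours is divisible by four, hence zero
(`IsCubicWeight.exists_coloring_of_even`).

Colourings take values in `ℤˣ = {1, -1}`. The middle part of the proof only uses the multiplicity
function of the multigraph, on the finite type of its vertices.
-/

namespace Graph

/-! ### Signed matchings -/

/-- `e` pairs up the elements of `X`, and the pair `{x, e x}` carries the sign `s x = s (e x)`.
A colouring `σ : V → ℤˣ` respects the signed matching when `σ (e x) = s x * σ x` on `X`, so that
the sign `1` asks for equal colours and the sign `-1` for different ones. -/
structure IsSignedMatching {V : Type*} (X : Finset V) (e : V → V) (s : V → ℤˣ) : Prop where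
  mem : ∀ x ∈ X, e x ∈ X
  ne : ∀ x ∈ X, e x ≠ x
  invol : ∀ x ∈ X, e (e x) = x
  sign : ∀ x ∈ X, s (e x) = s x

section SignedMatching

variable {V : Type*} [DecidableEq V] {X Y : Finset V} {e t : V → V} {s ρ : V → ℤˣ}

lemma IsSignedMatching.sdiff (h : IsSignedMatching X e s) {a : V} (ha : a ∈ X) :
    IsSignedMatching (X \ {a, e a}) e s := by
  have key : ∀ x ∈ X \ {a, e a}, x ∈ X ∧ x ≠ a ∧ x ≠ e a := by
    intro x hx
    simpa [not_or] using hx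
  refine ⟨fun x hx => ?_, fun x hx => h.ne x (key x hx).1, fun x hx => h.invol x (key x hx).1,
    fun x hx => h.sign x (key x hx).1⟩
  obtain ⟨h1, h2, h3⟩ := key x hx
  simp only [Finset.mem_sdiff, Finset.mem_insert, Finset.mem_singleton, not_or]
  refine ⟨h.mem x h1, fun h4 => h3 ?_, fun h4 => h2 ?_⟩
  · rw [← h4, h.invol x h1]
  · rw [← h.invol x h1, h4, h.invol a ha]

/-- Two elements `a`, `b` that are not matched to each other can be removed: their partners are
matched instead, with the sign that makes `σ b = r * σ a` recoverable. -/
lemma IsSignedMatching.splice (h : IsSignedMatching X e s) {a b : V} (ha : a ∈ X) (hb : b ∈ X)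
    (hab : a ≠ b) (heab : e a ≠ b) (r : ℤˣ) :
    ∃ e' s', IsSignedMatching (X \ {a, b}) e' s' ∧
      (∀ x, x ≠ e a → x ≠ e b → e' x = e x) ∧ e' (e a) = e b ∧ e' (e b) = e a ∧
      ∀ σ' : V → ℤˣ, (∀ x ∈ X \ {a, b}, σ' (e' x) = s' x * σ' x) →
        ∃ σ : V → ℤˣ, (∀ x ∈ X, σ (e x) = s x * σ x) ∧ σ b = r * σ a ∧
          ∀ x, x ≠ a → x ≠ b → σ x = σ' x := by
  have heba : e b ≠ a := fun h' => heab (by rw [← h', h.invol b hb])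
  have hee : e a ≠ e b := fun h' => hab (by rw [← h.invol a ha, h', h.invol b hb])
  have hea := h.ne a ha
  have heb := h.ne b hb
  have key : ∀ x ∈ X \ {a, b}, x ∈ X ∧ x ≠ a ∧ x ≠ b := by
    intro x hx
    simpa [not_or] using hx
  have key' : ∀ x, x ∈ X → x ≠ a → x ≠ b → x ∈ X \ {a, b} := by
    intro x h1 h2 h3
    simp [h1, h2, h3]
  have hea' : e a ∈ X \ {a, b} := key' _ (h.mem a ha) hea heab
  have heb' : e b ∈ X \ {a, b} := key' _ (h.mem b hb) heba heb
  have hne : ∀ x ∈ X, x ≠ e a → e x ≠ a := fun x hx h1 h2 => h1 (by rw [← h2, h.invol x hx])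
  have hne' : ∀ x ∈ X, x ≠ e b → e x ≠ b := fun x hx h1 h2 => h1 (by rw [← h2, h.invol x hx])
  have hne2 : ∀ x ∈ X, x ≠ a → e x ≠ e a := fun x hx h1 h2 =>
    h1 (by rw [← h.invol x hx, h2, h.invol a ha])
  have hne2' : ∀ x ∈ X, x ≠ b → e x ≠ e b := fun x hx h1 h2 =>
    h1 (by rw [← h.invol x hx, h2, h.invol b hb])
  refine ⟨fun x => if x = e a then e b else if x = e b then e a else e x,
    fun x => if x = e a ∨ x = e b then s a * r * s b else s x, ⟨?_, ?_, ?_, ?_⟩, ?_, ?_, ?_, ?_⟩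
  · intro x hx
    obtain ⟨h1, h2, h3⟩ := key x hx
    by_cases hxa : x = e a
    · simpa [hxa] using heb'
    by_cases hxb : x = e b
    · simpa [hxb, hee.symm] using hea'
    simpa only [hxa, hxb, if_false] using key' _ (h.mem x h1) (hne x h1 hxa) (hne' x h1 hxb)
  · intro x hx
    obtain ⟨h1, h2, h3⟩ := key x hx
    by_cases hxa : x = e a
    · simpa [hxa] using hee.symm
    by_cases hxb : x = e b
    · simpa [hxb, hee.symm] using hee
    simpa only [hxa, hxb, if_false] using h.ne x h1
  · intro x hx
    obtain ⟨h1, h2, h3⟩ := key x hx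
    by_cases hxa : x = e a
    · simp [hxa, hee.symm]
    by_cases hxb : x = e b
    · simp [hxb, hee.symm]
    simp only [hxa, hxb, if_false, hne2 x h1 h2, hne2' x h1 h3, h.invol x h1]
  · intro x hx
    obtain ⟨h1, h2, h3⟩ := key x hx
    by_cases hxa : x = e a
    · simp [hxa]
    by_cases hxb : x = e b
    · simp [hxb]
    simp only [hxa, hxb, if_false, hne2 x h1 h2, hne2' x h1 h3, h.sign x h1, or_self]
  · intro x h1 h2
    simp [h1, h2]
  · simp
  · simp [hee.symm]
  · intro σ' hσ'
    have hlink : σ' (e b) = s a * r * s b * σ' (e a) := by simpa using hσ' _ hea'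
    refine ⟨fun x => if x = a then s a * σ' (e a) else if x = b then s b * σ' (e b) else σ' x,
      ?_, ?_, ?_⟩
    · intro x hx
      by_cases hxa : x = a
      · subst hxa
        simp [hea, heab, ← mul_assoc]
      by_cases hxb : x = b
      · subst hxb
        simp [heb, heba, hab.symm, ← mul_assoc]
      by_cases hxa' : x = e a
      · simp [hxa', hea, heab, h.invol a ha, h.sign a ha]
      by_cases hxb' : x = e b
      · simp [hxb', heb, heba, h.invol b hb, h.sign b hb, hab.symm]
      have := hσ' x (key' x hx hxa hxb)
      simpa [hxa, hxb, hne x hx hxa', hne' x hx hxb', hxa', hxb'] using this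
    · simp only [hab.symm, if_false, if_true, hlink]
      rw [show s b * (s a * r * s b * σ' (e a)) = (s b * s b) * (r * (s a * σ' (e a))) by
        simp only [mul_comm, mul_left_comm], Int.units_mul_self, one_mul]
    · intro x h1 h2
      simp [h1, h2]

/-- A signed matching on its own can be respected with almost equal colour classes: the signs of
the pairs are free, so each new pair can be used to correct the sum. -/
lemma IsSignedMatching.exists_coloring (h : IsSignedMatching X e s) :
    ∃ σ : V → ℤˣ, (∀ x ∈ X, σ (e x) = s x * σ x) ∧ |∑ x ∈ X, (σ x : ℤ)| ≤ 2 := by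
  induction hn : X.card using Nat.strong_induction_on generalizing X with
  | _ n ih =>
  obtain rfl | ⟨a, ha⟩ := X.eq_empty_or_nonempty
  · exact ⟨1, by simp, by simp⟩
  have hsub : ({a, e a} : Finset V) ⊆ X := by
    intro x hx
    simp only [Finset.mem_insert, Finset.mem_singleton] at hx
    rcases hx with rfl | rfl
    exacts [ha, h.mem _ ha]
  have hea := h.ne a ha
  have hss : X \ {a, e a} ⊂ X := Finset.sdiff_ssubset hsub ⟨a, by simp⟩
  obtain ⟨σ', h1, h2⟩ := ih _ (hn ▸ Finset.card_lt_card hss) (h.sdiff ha) rfl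
  -- the colour `c` of `a` is opposite to the sign of the sum over the other pairs
  obtain ⟨c, hc⟩ : ∃ c : ℤˣ, |∑ x ∈ X \ {a, e a}, (σ' x : ℤ) + (c + (s a * c : ℤˣ) : ℤ)| ≤ 2 := by
    generalize ∑ x ∈ X \ {a, e a}, (σ' x : ℤ) = S at h2
    rw [abs_le] at h2
    rcases Int.units_eq_one_or (s a) with hs | hs <;> rw [hs]
    · by_cases hS : 0 < S
      · refine ⟨-1, ?_⟩
        rw [abs_le]
        push_cast
        omega
      · refine ⟨1, ?_⟩
        rw [abs_le]
        push_cast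
        omega
    · refine ⟨1, ?_⟩
      rw [abs_le]
      push_cast
      omega
  refine ⟨fun x => if x = a then c else if x = e a then s a * c else σ' x, ?_, ?_⟩
  · intro x hx
    by_cases hxa : x = a
    · subst hxa
      simp [hea]
    by_cases hxa' : x = e a
    · simp [hxa', hea, h.invol a ha, h.sign a ha, ← mul_assoc]
    have h3 : e x ≠ a := fun h4 => hxa' (by rw [← h4, h.invol x hx])
    have h4 : e x ≠ e a := fun h4 => hxa (by rw [← h.invol x hx, h4, h.invol a ha])
    simpa [hxa, hxa', h3, h4] using h1 x (by simp [hx, hxa, hxa'])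
  · rw [← Finset.sum_sdiff hsub, Finset.sum_pair hea.symm]
    have : ∀ x ∈ X \ {a, e a}, (((if x = a then c else if x = e a then s a * c else σ' x) : ℤˣ) : ℤ)
        = σ' x := by
      intro x hx
      have hx : x ≠ a ∧ x ≠ e a := by
        have := (Finset.mem_sdiff.1 hx).2
        simpa using this
      simp [hx.1, hx.2]
    rw [Finset.sum_congr rfl this]
    simpa [hea] using hc

/-- A signed matching can be respected with almost equal colour classes in such a way that no
triple of a disjoint family is monochromatic. In each triple two elements that are not matched to
each other are spliced away as a differently coloured pair. -/
lemma IsSignedMatching.exists_coloring_triples (h : IsSignedMatching X e s)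
    (𝒯 : Finset (Finset V)) (hsub : ∀ T ∈ 𝒯, T ⊆ X) (hcard : ∀ T ∈ 𝒯, T.card = 3)
    (hdisj : ∀ S ∈ 𝒯, ∀ T ∈ 𝒯, S ≠ T → Disjoint S T) :
    ∃ σ : V → ℤˣ, (∀ x ∈ X, σ (e x) = s x * σ x) ∧
      (∀ T ∈ 𝒯, ∃ x ∈ T, ∃ y ∈ T, σ x ≠ σ y) ∧ |∑ x ∈ X, (σ x : ℤ)| ≤ 2 := by
  induction 𝒯 using Finset.induction_on generalizing X e s with
  | empty =>
    obtain ⟨σ, h1, h2⟩ := h.exists_coloring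
    exact ⟨σ, h1, by simp, h2⟩
  | insert T 𝒯 hT ih =>
    obtain ⟨a, b, haT, hbT, hab, heab⟩ : ∃ a b, a ∈ T ∧ b ∈ T ∧ a ≠ b ∧ e a ≠ b := by
      obtain ⟨a, b, c, hab, hac, hbc, hT3⟩ := Finset.card_eq_three.1 (hcard T (by simp))
      by_cases h1 : e a = b
      · exact ⟨a, c, by simp [hT3], by simp [hT3], hac, by rw [h1]; exact hbc⟩
      · exact ⟨a, b, by simp [hT3], by simp [hT3], hab, h1⟩
    have ha := hsub T (by simp) haT
    have hb := hsub T (by simp) hbT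
    have hdT : ∀ S ∈ 𝒯, Disjoint S T := fun S hS =>
      hdisj S (by simp [hS]) T (by simp) (by rintro rfl; exact hT hS)
    have hnot : ∀ S ∈ 𝒯, ∀ x ∈ S, x ≠ a ∧ x ≠ b := fun S hS x hx =>
      ⟨by rintro rfl; exact Finset.disjoint_left.1 (hdT S hS) hx haT,
        by rintro rfl; exact Finset.disjoint_left.1 (hdT S hS) hx hbT⟩
    obtain ⟨e', s', h', -, -, -, hext⟩ := h.splice ha hb hab heab (-1)
    obtain ⟨σ', h1, h2, h3⟩ := ih h'
      (fun S hS x hx => by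
        have := hnot S hS x hx
        simp [this.1, this.2, hsub S (by simp [hS]) hx])
      (fun S hS => hcard S (by simp [hS]))
      (fun S hS S' hS' => hdisj S (by simp [hS]) S' (by simp [hS']))
    obtain ⟨σ, h4, h5, h6⟩ := hext σ' h1
    refine ⟨σ, h4, ?_, ?_⟩
    · intro S hS
      rcases Finset.mem_insert.1 hS with rfl | hS
      · refine ⟨a, haT, b, hbT, ?_⟩
        rw [h5]
        rcases Int.units_eq_one_or (σ a) with hs | hs <;> rw [hs] <;> decide
      · obtain ⟨x, hx, y, hy, hxy⟩ := h2 S hS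
        refine ⟨x, hx, y, hy, ?_⟩
        rwa [h6 x (hnot S hS x hx).1 (hnot S hS x hx).2, h6 y (hnot S hS y hy).1 (hnot S hS y hy).2]
    · have hsub' : ({a, b} : Finset V) ⊆ X := by
        intro x hx
        simp only [Finset.mem_insert, Finset.mem_singleton] at hx
        rcases hx with rfl | rfl <;> assumption
      rw [← Finset.sum_sdiff hsub', Finset.sum_pair hab, h5]
      rw [Finset.sum_congr rfl (g := fun x => (σ' x : ℤ))]
      · push_cast
        simpa using h3
      · intro x hx
        have hx : x ≠ a ∧ x ≠ b := by
          have := (Finset.mem_sdiff.1 hx).2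
          simpa using this
        rw [h6 x hx.1 hx.2]

/-- Two signed matchings, the second one on a subset `Y` of `X`, can be respected at the same time
if their union has no closed cycle, that is, if no nonempty subset of `Y` is closed under both. The
pairs of the second matching are spliced away one by one. -/
lemma IsSignedMatching.exists_coloring_two (h : IsSignedMatching X e s)
    (hY : IsSignedMatching Y t ρ) (hYX : Y ⊆ X)
    (hacyc : ∀ Z ⊆ Y, (∀ x ∈ Z, e x ∈ Z) → (∀ x ∈ Z, t x ∈ Z) → Z = ∅)
    (𝒯 : Finset (Finset V)) (hsub : ∀ T ∈ 𝒯, T ⊆ X \ Y) (hcard : ∀ T ∈ 𝒯, T.card = 3)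
    (hdisj : ∀ S ∈ 𝒯, ∀ T ∈ 𝒯, S ≠ T → Disjoint S T) :
    ∃ σ : V → ℤˣ, (∀ x ∈ X, σ (e x) = s x * σ x) ∧ (∀ x ∈ Y, σ (t x) = ρ x * σ x) ∧
      (∀ T ∈ 𝒯, ∃ x ∈ T, ∃ y ∈ T, σ x ≠ σ y) ∧ |∑ x ∈ X \ Y, (σ x : ℤ)| ≤ 2 := by
  induction hn : Y.card using Nat.strong_induction_on generalizing X Y e s with
  | _ n ih =>
  obtain rfl | ⟨a, ha⟩ := Y.eq_empty_or_nonempty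
  · rw [Finset.sdiff_empty] at *
    obtain ⟨σ, h1, h2, h3⟩ := h.exists_coloring_triples 𝒯 hsub hcard hdisj
    exact ⟨σ, h1, by simp, h2, h3⟩
  have hta := hY.mem a ha
  have hab := hY.ne a ha
  have heab : e a ≠ t a := by
    intro h1
    refine Finset.ne_empty_of_mem (a := a) (s := {a, t a}) (by simp) (hacyc {a, t a} ?_ ?_ ?_)
    · intro x hx
      simp only [Finset.mem_insert, Finset.mem_singleton] at hx
      rcases hx with rfl | rfl <;> assumption
    · intro x hx
      simp only [Finset.mem_insert, Finset.mem_singleton] at hx ⊢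
      rcases hx with rfl | rfl
      · exact Or.inr h1
      · rw [← h1, h.invol a (hYX ha)]
        simp
    · intro x hx
      simp only [Finset.mem_insert, Finset.mem_singleton] at hx ⊢
      rcases hx with rfl | rfl
      · simp
      · simp [hY.invol a ha]
  have hsubY : ({a, t a} : Finset V) ⊆ Y := by
    intro x hx
    simp only [Finset.mem_insert, Finset.mem_singleton] at hx
    rcases hx with rfl | rfl <;> assumption
  have hss : Y \ {a, t a} ⊂ Y := Finset.sdiff_ssubset hsubY ⟨a, by simp⟩
  obtain ⟨e', s', h', he1, he2, he3, hext⟩ :=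
    h.splice (hYX ha) (hYX hta) hab.symm heab (ρ a)
  have hXY : (X \ {a, t a}) \ (Y \ {a, t a}) = X \ Y := by
    ext x
    simp only [Finset.mem_sdiff]
    constructor
    · rintro ⟨⟨h1, h2⟩, h3⟩
      exact ⟨h1, fun h4 => h3 ⟨h4, h2⟩⟩
    · rintro ⟨h1, h2⟩
      exact ⟨⟨h1, fun h3 => h2 (hsubY h3)⟩, fun h3 => h2 h3.1⟩
  obtain ⟨σ', h1, h2, h3, h4⟩ := ih _ (hn ▸ Finset.card_lt_card hss) h' (hY.sdiff ha)
    (Finset.sdiff_subset_sdiff hYX (Finset.Subset.refl _)) (by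
      intro Z hZ hZe hZt
      have hiff : e a ∈ Z ↔ e (t a) ∈ Z :=
        ⟨fun h5 => he2 ▸ hZe _ h5, fun h5 => he3 ▸ hZe _ h5⟩
      have hZY : Z ⊆ Y := hZ.trans Finset.sdiff_subset
      -- a set closed after the splice is closed before it, up to adding the two spliced elements
      by_cases h5 : e a ∈ Z
      · have hemp := hacyc (Z ∪ {a, t a}) (Finset.union_subset hZY hsubY) ?_ ?_
        · exact (Finset.union_eq_empty.1 hemp).1
        · intro x hx
          simp only [Finset.mem_union, Finset.mem_insert, Finset.mem_singleton] at hx ⊢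
          rcases hx with hx | rfl | rfl
          · by_cases h6 : x = e a
            · simp [h6, h.invol a (hYX ha)]
            by_cases h7 : x = e (t a)
            · simp [h7, h.invol _ (hYX hta)]
            exact Or.inl (he1 x h6 h7 ▸ hZe x hx)
          · exact Or.inl h5
          · exact Or.inl (hiff.1 h5)
        · intro x hx
          simp only [Finset.mem_union, Finset.mem_insert, Finset.mem_singleton] at hx ⊢
          rcases hx with hx | rfl | rfl
          · exact Or.inl (hZt x hx)
          · simp
          · simp [hY.invol a ha]
      · refine hacyc Z hZY (fun x hx => ?_) hZt
        rw [← he1 x (by rintro rfl; exact h5 hx) (by rintro rfl; exact h5 (hiff.2 hx))]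
        exact hZe x hx)
    (fun T hT => by rw [hXY]; exact hsub T hT) rfl
  rw [hXY] at h4
  obtain ⟨σ, h5, h6, h7⟩ := hext σ' h1
  have h8 : ∀ x ∈ X \ Y, σ x = σ' x := by
    intro x hx
    refine h7 x ?_ ?_
    · rintro rfl
      exact (Finset.mem_sdiff.1 hx).2 ha
    · rintro rfl
      exact (Finset.mem_sdiff.1 hx).2 hta
  refine ⟨σ, h5, ?_, ?_, ?_⟩
  · intro x hx
    by_cases hxa : x = a
    · rw [hxa, h6]
    by_cases hxb : x = t a
    · rw [hxb, hY.invol a ha, h6, hY.sign a ha, ← mul_assoc, Int.units_mul_self, one_mul]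
    have h9 : t x ≠ a := fun h4 => hxb (by rw [← h4, hY.invol x hx])
    have h10 : t x ≠ t a := fun h4 => hxa (by rw [← hY.invol x hx, h4, hY.invol a ha])
    rw [h7 x hxa hxb, h7 _ h9 h10]
    exact h2 x (by simp [hx, hxa, hxb])
  · intro T hT
    obtain ⟨x, hx, y, hy, hxy⟩ := h3 T hT
    exact ⟨x, hx, y, hy, by rwa [h8 x (hsub T hT hx), h8 y (hsub T hT hy)]⟩
  · rwa [Finset.sum_congr rfl (fun x hx => by rw [h8 x hx])]

end SignedMatching

/-! ### Units: digons, diamonds and the other triangles -/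

/-- The multiplicity function `m` of a connected claw-free cubic loopless multigraph on a finite
vertex type, other than `K_4`. -/
structure IsCubicWeight {V : Type*} [Fintype V] (m : V → V → ℕ) : Prop where
  symm : ∀ x y, m x y = m y x
  self : ∀ x, m x x = 0
  sum : ∀ x, ∑ y, m x y = 3
  claw : ∀ x a b c, a ≠ b → a ≠ c → b ≠ c → m x a = 1 → m x b = 1 → m x c = 1 →
    m a b ≠ 0 ∨ m a c ≠ 0 ∨ m b c ≠ 0
  conn : ∀ Z : Finset V, Z.Nonempty → (∀ x ∈ Z, ∀ y, 0 < m x y → y ∈ Z) → ∀ x, x ∈ Z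
  not_K4 : ∀ a b c d, m a b = 1 → m a c = 1 → m a d = 1 → m b c = 1 → m b d = 1 → m c d = 1 →
    ¬ ∀ x, x = a ∨ x = b ∨ x = c ∨ x = d

/-- The vertices `a, b, c, d` induce a diamond with ends `a, b` and centres `c, d`. -/
def DiamondAt {V : Type*} (m : V → V → ℕ) (a b c d : V) : Prop :=
  a ≠ b ∧ m a b = 0 ∧ m a c = 1 ∧ m a d = 1 ∧ m b c = 1 ∧ m b d = 1 ∧ m c d = 1

/-- `x` and `y` are joined by an edge that is parallel to another edge or lies in a triangle. -/
def TiedTo {V : Type*} (m : V → V → ℕ) (x y : V) : Prop :=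
  0 < m x y ∧ (2 ≤ m x y ∨ ∃ z, 0 < m x z ∧ 0 < m y z)

open Classical in
/-- The vertex sets of the diamonds. -/
noncomputable def diamonds {V : Type*} [Fintype V] (m : V → V → ℕ) : Finset (Finset V) :=
  {S | ∃ a b c d, S = {a, b, c, d} ∧ DiamondAt m a b c d}

open Classical in
/-- The vertex sets of the digons. -/
noncomputable def digons {V : Type*} [Fintype V] (m : V → V → ℕ) : Finset (Finset V) :=
  {S | ∃ x y, S = {x, y} ∧ 2 ≤ m x y ∧ ∀ z, 0 < m x z → ¬ 0 < m y z}

open Classical in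
/-- The vertex sets of the triangles that are not contained in a diamond. The triangle may have a
double side, and then it is a trumpet. -/
noncomputable def triangles {V : Type*} [Fintype V] (m : V → V → ℕ) : Finset (Finset V) :=
  {S | ∃ x y z, S = {x, y, z} ∧ 0 < m x y ∧ 0 < m x z ∧ 0 < m y z ∧ ∀ D ∈ diamonds m, ¬ S ⊆ D}

open Classical in
/-- The digons, the diamonds and the triangles outside diamonds. They partition the vertices. -/
noncomputable def units {V : Type*} [Fintype V] (m : V → V → ℕ) : Finset (Finset V) :=
  digons m ∪ triangles m ∪ diamonds m

open Classical in
/-- The vertices that can be reached from `x` along edges that are parallel to another edge or lie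
in a triangle. This is the unit that contains `x`. -/
noncomputable def unitOf {V : Type*} [Fintype V] (m : V → V → ℕ) (x : V) : Finset V :=
  {y | Relation.ReflTransGen (TiedTo m) x y}

section Units

variable {V : Type*} [Fintype V] {m : V → V → ℕ}

lemma mem_diamonds {S : Finset V} [DecidableEq V] :
    S ∈ diamonds m ↔ ∃ a b c d, S = {a, b, c, d} ∧ DiamondAt m a b c d := by
  classical
  simp only [diamonds, Finset.mem_filter, Finset.mem_univ, true_and]
  convert Iff.rfl

lemma mem_digons {S : Finset V} [DecidableEq V] :
    S ∈ digons m ↔ ∃ x y, S = {x, y} ∧ 2 ≤ m x y ∧ ∀ z, 0 < m x z → ¬ 0 < m y z := by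
  classical
  simp only [digons, Finset.mem_filter, Finset.mem_univ, true_and]
  convert Iff.rfl

lemma mem_triangles {S : Finset V} [DecidableEq V] :
    S ∈ triangles m ↔ ∃ x y z, S = {x, y, z} ∧ 0 < m x y ∧ 0 < m x z ∧ 0 < m y z ∧
      ∀ D ∈ diamonds m, ¬ S ⊆ D := by
  classical
  simp only [triangles, Finset.mem_filter, Finset.mem_univ, true_and]
  convert Iff.rfl

lemma mem_units {S : Finset V} :
    S ∈ units m ↔ S ∈ digons m ∨ S ∈ triangles m ∨ S ∈ diamonds m := by
  classical
  simp [units]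

lemma mem_unitOf (x : V) : x ∈ unitOf m x := by
  simp only [unitOf, Finset.mem_filter, Finset.mem_univ, true_and]
  exact .refl

namespace IsCubicWeight

variable (hm : IsCubicWeight m)
include hm

lemma ne {x y : V} (h : 0 < m x y) : x ≠ y := by
  rintro rfl
  rw [hm.self] at h
  exact lt_irrefl _ h

lemma sum_two_le (x : V) {y z : V} (h : y ≠ z) : m x y + m x z ≤ 3 := by
  classical
  have := Finset.sum_le_sum_of_subset (f := m x) (Finset.subset_univ {y, z})
  rwa [Finset.sum_pair h, hm.sum] at this

lemma sum_three_le (x : V) {y z w : V} (h1 : y ≠ z) (h2 : y ≠ w) (h3 : z ≠ w) :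
    m x y + m x z + m x w ≤ 3 := by
  classical
  have := Finset.sum_le_sum_of_subset (f := m x) (Finset.subset_univ {y, z, w})
  rw [Finset.sum_insert (by simp [h1, h2]), Finset.sum_pair h3, hm.sum] at this
  omega

lemma sum_four_le (x : V) {y z w u : V} (h1 : y ≠ z) (h2 : y ≠ w) (h3 : z ≠ w) (h4 : u ≠ y)
    (h5 : u ≠ z) (h6 : u ≠ w) : m x y + m x z + m x w + m x u ≤ 3 := by
  classical
  have := Finset.sum_le_sum_of_subset (f := m x) (Finset.subset_univ {u, y, z, w})
  rw [Finset.sum_insert (by simp [h4, h5, h6]), Finset.sum_insert (by simp [h1, h2]),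
    Finset.sum_pair h3, hm.sum] at this
  omega

/-- A vertex with three known neighbours has no other ones. -/
lemma eq_of_three {x y z w u : V} (hy : 0 < m x y) (hz : 0 < m x z) (hw : 0 < m x w)
    (h1 : y ≠ z) (h2 : y ≠ w) (h3 : z ≠ w) (hu : 0 < m x u) : u = y ∨ u = z ∨ u = w := by
  by_contra! h
  have := hm.sum_four_le x h1 h2 h3 h.1 h.2.1 h.2.2
  omega

lemma diamondAt_swap_ends {a b c d : V} (h : DiamondAt m a b c d) : DiamondAt m b a c d := by
  obtain ⟨h1, h2, h3, h4, h5, h6, h7⟩ := h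
  exact ⟨h1.symm, hm.symm a b ▸ h2, h5, h6, h3, h4, h7⟩

lemma diamondAt_swap_centres {a b c d : V} (h : DiamondAt m a b c d) : DiamondAt m a b d c := by
  obtain ⟨h1, h2, h3, h4, h5, h6, h7⟩ := h
  exact ⟨h1, h2, h4, h3, h6, h5, hm.symm c d ▸ h7⟩

lemma diamondAt_ne {a b c d : V} (h : DiamondAt m a b c d) :
    a ≠ b ∧ a ≠ c ∧ a ≠ d ∧ b ≠ c ∧ b ≠ d ∧ c ≠ d := by
  obtain ⟨h1, h2, h3, h4, h5, h6, h7⟩ := h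
  exact ⟨h1, hm.ne (by omega), hm.ne (by omega), hm.ne (by omega), hm.ne (by omega),
    hm.ne (by omega)⟩

lemma diamondAt_centre {a b c d w : V} (h : DiamondAt m a b c d) (hw : 0 < m c w) :
    w = a ∨ w = b ∨ w = d := by
  obtain ⟨n1, n2, n3, n4, n5, n6⟩ := hm.diamondAt_ne h
  obtain ⟨h1, h2, h3, h4, h5, h6, h7⟩ := h
  rw [hm.symm] at h3 h5
  exact hm.eq_of_three (by omega) (by omega) (by omega) n1 n3 n5 hw

lemma diamondAt_end {a b c d w : V} (h : DiamondAt m a b c d) (hw : TiedTo m a w) :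
    w = c ∨ w = d := by
  by_contra! hcon
  obtain ⟨n1, n2, n3, n4, n5, n6⟩ := hm.diamondAt_ne h
  have h' := h
  obtain ⟨h1, h2, h3, h4, h5, h6, h7⟩ := h
  obtain ⟨hw1, hw2⟩ := hw
  have hwa := hm.ne hw1
  have hwb : w ≠ b := by rintro rfl; omega
  have := hm.sum_three_le a n6 hcon.1.symm hcon.2.symm
  obtain hw2 | ⟨z, hz1, hz2⟩ := hw2
  · omega
  rcases hm.eq_of_three (by omega) (by omega) hw1 n6 hcon.1.symm hcon.2.symm hz1 with
    rfl | rfl | rfl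
  · rcases hm.diamondAt_centre h' (hm.symm w z ▸ hz2) with rfl | rfl | rfl
    · exact hwa rfl
    · exact hwb rfl
    · exact hcon.2 rfl
  · rcases hm.diamondAt_centre (hm.diamondAt_swap_centres h') (hm.symm w z ▸ hz2) with
      rfl | rfl | rfl
    · exact hwa rfl
    · exact hwb rfl
    · exact hcon.1 rfl
  · exact hm.ne hz2 rfl

/-- Four pairwise adjacent vertices would span all of the graph, which is not `K_4`. -/
lemma not_pairwise_adj {a b c d : V} (h1 : 0 < m a b) (h2 : 0 < m a c) (h3 : 0 < m a d)
    (h4 : 0 < m b c) (h5 : 0 < m b d) (h6 : 0 < m c d) : False := by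
  classical
  have n1 := hm.ne h1
  have n2 := hm.ne h2
  have n3 := hm.ne h3
  have n4 := hm.ne h4
  have n5 := hm.ne h5
  have n6 := hm.ne h6
  have ha := hm.sum_three_le a n4 n5 n6
  have hb := hm.sum_three_le b n2 n3 n6
  have hc := hm.sum_three_le c n1 n3 n5
  have hd := hm.sum_three_le d n1 n2 n4
  have s1 := hm.symm a b
  have s2 := hm.symm a c
  have s3 := hm.symm a d
  have s4 := hm.symm b c
  have s5 := hm.symm b d
  have s6 := hm.symm c d
  refine hm.not_K4 a b c d (by omega) (by omega) (by omega) (by omega) (by omega) (by omega) ?_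
  have := hm.conn {a, b, c, d} ⟨a, by simp⟩ ?_
  · simpa using this
  intro x hx y hxy
  simp only [Finset.mem_insert, Finset.mem_singleton] at hx ⊢
  rcases hx with rfl | rfl | rfl | rfl
  · rcases hm.eq_of_three h1 h2 h3 n4 n5 n6 hxy with rfl | rfl | rfl <;> simp
  · rcases hm.eq_of_three (s1 ▸ h1) h4 h5 n2 n3 n6 hxy with rfl | rfl | rfl <;> simp
  · rcases hm.eq_of_three (s2 ▸ h2) (s4 ▸ h4) h6 n1 n3 n5 hxy with rfl | rfl | rfl <;> simp
  · rcases hm.eq_of_three (s3 ▸ h3) (s5 ▸ h5) (s6 ▸ h6) n1 n2 n4 hxy with rfl | rfl | rfl <;> simp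

/-- Two triangles with a common edge form a diamond. -/
lemma exists_diamond [DecidableEq V] {x y z w : V} (h1 : 0 < m x y) (h2 : 0 < m x z)
    (h3 : 0 < m y z) (h4 : 0 < m x w) (h5 : 0 < m y w) (hzw : z ≠ w) :
    ({x, y, z, w} : Finset V) ∈ diamonds m := by
  have n1 := hm.ne h1
  have n2 := hm.ne h2
  have n3 := hm.ne h3
  have n4 := hm.ne h4
  have n5 := hm.ne h5
  have hx := hm.sum_three_le x n3 n5 hzw
  have hy := hm.sum_three_le y n2 n4 hzw
  have s1 := hm.symm x y
  have s2 := hm.symm x z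
  have s3 := hm.symm y z
  have s4 := hm.symm x w
  have s5 := hm.symm y w
  by_cases h6 : m z w = 0
  · refine mem_diamonds.2 ⟨z, w, x, y, ?_, hzw, h6, ?_⟩
    · ext u
      simp only [Finset.mem_insert, Finset.mem_singleton]
      tauto
    · omega
  · exact (hm.not_pairwise_adj h1 h2 h4 h3 h5 (Nat.pos_of_ne_zero h6)).elim

lemma triangle_closed [DecidableEq V] {x y z w : V} (h1 : 0 < m x y) (h2 : 0 < m x z)
    (h3 : 0 < m y z) (hD : ∀ D ∈ diamonds m, ¬ ({x, y, z} : Finset V) ⊆ D) (hw : TiedTo m x w) :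
    w = y ∨ w = z := by
  by_contra! hcon
  have n3 := hm.ne h3
  obtain ⟨hw1, hw2⟩ := hw
  have := hm.sum_three_le x n3 hcon.1.symm hcon.2.symm
  obtain hw2 | ⟨u, hu1, hu2⟩ := hw2
  · omega
  rcases hm.eq_of_three h1 h2 hw1 n3 hcon.1.symm hcon.2.symm hu1 with rfl | rfl | rfl
  · refine hD _ (hm.exists_diamond h1 h2 h3 hw1 (hm.symm w u ▸ hu2) hcon.2.symm) ?_
    intro v
    simp only [Finset.mem_insert, Finset.mem_singleton]
    tauto
  · refine hD _ (hm.exists_diamond h2 h1 (hm.symm y u ▸ h3) hw1 (hm.symm w u ▸ hu2) hcon.1.symm) ?_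
    intro v
    simp only [Finset.mem_insert, Finset.mem_singleton]
    tauto
  · exact hm.ne hu2 rfl

lemma tiedTo_symm {x y : V} (h : TiedTo m x y) : TiedTo m y x := by
  obtain ⟨h1, h2⟩ := h
  refine ⟨hm.symm x y ▸ h1, ?_⟩
  rcases h2 with h2 | ⟨z, h3, h4⟩
  · exact Or.inl (hm.symm x y ▸ h2)
  · exact Or.inr ⟨z, h4, h3⟩

lemma digon_closed {x y w : V} (h1 : 2 ≤ m x y) (h2 : ∀ z, 0 < m x z → ¬ 0 < m y z)
    (hw : TiedTo m x w) : w = y := by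
  by_contra hcon
  obtain ⟨hw1, hw2⟩ := hw
  have := hm.sum_two_le x hcon
  obtain hw2 | ⟨z, hz1, hz2⟩ := hw2
  · omega
  by_cases hzy : z = y
  · subst hzy
    exact h2 w hw1 (hm.symm w z ▸ hz2)
  · have := hm.sum_three_le x hcon (hm.ne hz2) (Ne.symm hzy)
    omega

lemma unit_closed {S : Finset V} (hS : S ∈ units m) {x y : V} (hx : x ∈ S) (hxy : TiedTo m x y) :
    y ∈ S := by
  classical
  rcases mem_units.1 hS with h | h | h
  · obtain ⟨a, b, rfl, h1, h2⟩ := mem_digons.1 h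
    simp only [Finset.mem_insert, Finset.mem_singleton] at hx ⊢
    rcases hx with rfl | rfl
    · exact Or.inr (hm.digon_closed h1 h2 hxy)
    · exact Or.inl (hm.digon_closed (hm.symm a x ▸ h1) (fun z hz hz' => h2 z hz' hz) hxy)
  · obtain ⟨a, b, c, rfl, h1, h2, h3, h4⟩ := mem_triangles.1 h
    simp only [Finset.mem_insert, Finset.mem_singleton] at hx ⊢
    rcases hx with rfl | rfl | rfl
    · exact Or.inr (hm.triangle_closed h1 h2 h3 h4 hxy)
    · rw [Finset.insert_comm] at h4
      rcases hm.triangle_closed (hm.symm a x ▸ h1) h3 h2 h4 hxy with h | h <;> simp [h]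
    · rw [Finset.pair_comm, Finset.insert_comm] at h4
      rcases hm.triangle_closed (hm.symm a x ▸ h2) (hm.symm b x ▸ h3) h1 h4 hxy with h | h <;>
        simp [h]
  · obtain ⟨a, b, c, d, rfl, hD⟩ := mem_diamonds.1 h
    simp only [Finset.mem_insert, Finset.mem_singleton] at hx ⊢
    rcases hx with rfl | rfl | rfl | rfl
    · rcases hm.diamondAt_end hD hxy with h | h <;> simp [h]
    · rcases hm.diamondAt_end (hm.diamondAt_swap_ends hD) hxy with h | h <;> simp [h]
    · rcases hm.diamondAt_centre hD hxy.1 with h | h | h <;> simp [h]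
    · rcases hm.diamondAt_centre (hm.diamondAt_swap_centres hD) hxy.1 with h | h | h <;> simp [h]

lemma unit_connected {S : Finset V} (hS : S ∈ units m) {x y : V} (hx : x ∈ S) (hy : y ∈ S) :
    Relation.ReflTransGen (TiedTo m) x y := by
  classical
  have : Std.Symm (TiedTo m) := ⟨fun _ _ h => hm.tiedTo_symm h⟩
  have hsymm : Std.Symm (Relation.ReflTransGen (TiedTo m)) := inferInstance
  -- it is enough to reach one vertex of the unit from all of them
  suffices h : ∃ c, ∀ v ∈ S, Relation.ReflTransGen (TiedTo m) c v by
    obtain ⟨c, hc⟩ := h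
    exact (hsymm.symm _ _ (hc x hx)).trans (hc y hy)
  rcases mem_units.1 hS with h | h | h
  · obtain ⟨a, b, rfl, h1, h2⟩ := mem_digons.1 h
    refine ⟨a, fun v hv => ?_⟩
    simp only [Finset.mem_insert, Finset.mem_singleton] at hv
    rcases hv with rfl | rfl
    · exact .refl
    · exact .single ⟨by omega, Or.inl h1⟩
  · obtain ⟨a, b, c, rfl, h1, h2, h3, h4⟩ := mem_triangles.1 h
    refine ⟨a, fun v hv => ?_⟩
    simp only [Finset.mem_insert, Finset.mem_singleton] at hv
    rcases hv with rfl | rfl | rfl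
    · exact .refl
    · exact .single ⟨h1, Or.inr ⟨c, h2, h3⟩⟩
    · exact .single ⟨h2, Or.inr ⟨b, h1, hm.symm b v ▸ h3⟩⟩
  · obtain ⟨a, b, c, d, rfl, h1, h2, h3, h4, h5, h6, h7⟩ := mem_diamonds.1 h
    have s1 := hm.symm a c
    have s2 := hm.symm b c
    have s3 := hm.symm a d
    have s4 := hm.symm b d
    refine ⟨c, fun v hv => ?_⟩
    simp only [Finset.mem_insert, Finset.mem_singleton] at hv
    rcases hv with rfl | rfl | rfl | rfl
    · exact .single ⟨by omega, Or.inr ⟨d, by omega, by omega⟩⟩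
    · exact .single ⟨by omega, Or.inr ⟨d, by omega, by omega⟩⟩
    · exact .refl
    · exact .single ⟨by omega, Or.inr ⟨a, by omega, by omega⟩⟩

lemma unitOf_eq {S : Finset V} (hS : S ∈ units m) {x : V} (hx : x ∈ S) : unitOf m x = S := by
  ext y
  simp only [unitOf, Finset.mem_filter, Finset.mem_univ, true_and]
  refine ⟨fun h => ?_, fun h => hm.unit_connected hS hx h⟩
  induction h with
  | refl => exact hx
  | tail _ h ih => exact hm.unit_closed hS ih h

/-- In a claw-free cubic multigraph every vertex lies in a triangle or on a multiple edge. -/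
lemma exists_unit (x : V) : ∃ S ∈ units m, x ∈ S := by
  classical
  have htri : ∀ y z, 0 < m x y → 0 < m x z → 0 < m y z → ∃ S ∈ units m, x ∈ S := by
    intro y z h1 h2 h3
    by_cases hD : ∀ D ∈ diamonds m, ¬ ({x, y, z} : Finset V) ⊆ D
    · exact ⟨{x, y, z}, mem_units.2 (Or.inr (Or.inl (mem_triangles.2
        ⟨x, y, z, rfl, h1, h2, h3, hD⟩))), by simp⟩
    · push Not at hD
      obtain ⟨D, hD, hsub⟩ := hD
      exact ⟨D, mem_units.2 (Or.inr (Or.inr hD)), hsub (by simp)⟩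
  by_cases h2 : ∃ y, 2 ≤ m x y
  · obtain ⟨y, hy⟩ := h2
    by_cases h3 : ∃ z, 0 < m x z ∧ 0 < m y z
    · obtain ⟨z, hz, hz'⟩ := h3
      exact htri y z (by omega) hz hz'
    · push Not at h3
      exact ⟨{x, y}, mem_units.2 (Or.inl (mem_digons.2 ⟨x, y, rfl, hy, fun z hz => by
        simpa using h3 z hz⟩)), by simp⟩
  · push Not at h2
    have hcard : 2 < (Finset.univ.filter fun y => m x y = 1).card := by
      have h4 := hm.sum x
      have h5 : ∀ y, m x y = if m x y = 1 then 1 else 0 := by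
        intro y
        have := h2 y
        split_ifs <;> omega
      rw [Finset.sum_congr rfl (fun y _ => h5 y), ← Finset.card_filter] at h4
      omega
    obtain ⟨a, ha, b, hb, c, hc, hab, hac, hbc⟩ := Finset.two_lt_card.1 hcard
    simp only [Finset.mem_filter, Finset.mem_univ, true_and] at ha hb hc
    rcases hm.claw x a b c hab hac hbc ha hb hc with h | h | h
    · exact htri a b (by omega) (by omega) (by omega)
    · exact htri a c (by omega) (by omega) (by omega)
    · exact htri b c (by omega) (by omega) (by omega)

lemma unitOf_mem (x : V) : unitOf m x ∈ units m := by
  obtain ⟨S, hS, hx⟩ := hm.exists_unit x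
  rwa [hm.unitOf_eq hS hx]

lemma units_disjoint {S T : Finset V} (hS : S ∈ units m) (hT : T ∈ units m) (h : S ≠ T) :
    Disjoint S T :=
  Finset.disjoint_left.2 fun x hxS hxT =>
    h (by rw [← hm.unitOf_eq hS hxS, ← hm.unitOf_eq hT hxT])

lemma card_digon {S : Finset V} (hS : S ∈ digons m) : S.card = 2 := by
  classical
  obtain ⟨x, y, rfl, h1, -⟩ := mem_digons.1 hS
  exact Finset.card_pair (hm.ne (by omega))

lemma card_triangle {S : Finset V} (hS : S ∈ triangles m) : S.card = 3 := by
  classical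
  obtain ⟨x, y, z, rfl, h1, h2, h3, -⟩ := mem_triangles.1 hS
  exact Finset.card_eq_three.2 ⟨x, y, z, hm.ne h1, hm.ne h2, hm.ne h3, rfl⟩

lemma card_diamond {S : Finset V} (hS : S ∈ diamonds m) : S.card = 4 := by
  classical
  obtain ⟨a, b, c, d, rfl, h⟩ := mem_diamonds.1 hS
  obtain ⟨n1, n2, n3, n4, n5, n6⟩ := hm.diamondAt_ne h
  rw [Finset.card_insert_of_notMem (by simp [n1, n2, n3]),
    Finset.card_insert_of_notMem (by simp [n4, n5]), Finset.card_pair n6]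

lemma sum_units {M : Type*} [AddCommMonoid M] (f : V → M) :
    ∑ S ∈ units m, ∑ x ∈ S, f x = ∑ x, f x := by
  classical
  rw [← Finset.sum_biUnion]
  · refine Finset.sum_congr ?_ fun _ _ => rfl
    ext x
    simp only [Finset.mem_biUnion, Finset.mem_univ, iff_true]
    exact hm.exists_unit x
  · intro S hS T hT h
    exact hm.units_disjoint hS hT h

lemma sum_units_eq {M : Type*} [AddCommMonoid M] (g : Finset V → M) :
    ∑ S ∈ units m, g S =
      ∑ S ∈ digons m, g S + ∑ S ∈ triangles m, g S + ∑ S ∈ diamonds m, g S := by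
  classical
  rw [units, Finset.sum_union, Finset.sum_union]
  · refine Finset.disjoint_left.2 fun S h1 h2 => ?_
    have := hm.card_digon h1
    have := hm.card_triangle h2
    omega
  · refine Finset.disjoint_left.2 fun S h1 h2 => ?_
    have h3 := hm.card_diamond h2
    rcases Finset.mem_union.1 h1 with h1 | h1
    · have := hm.card_digon h1
      omega
    · have := hm.card_triangle h1
      omega

lemma card_eq : Fintype.card V =
    2 * (digons m).card + 3 * (triangles m).card + 4 * (diamonds m).card := by
  have h := hm.sum_units (fun _ => 1)
  simp only [Finset.sum_const, smul_eq_mul, mul_one, Finset.card_univ] at h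
  rw [← h, hm.sum_units_eq, Finset.sum_congr rfl fun S hS => hm.card_digon hS,
    Finset.sum_congr rfl fun S hS => hm.card_triangle hS,
    Finset.sum_congr rfl fun S hS => hm.card_diamond hS]
  simp [mul_comm]

end IsCubicWeight

end Units

/-! ### Ports and the edges between units -/

section Ports

variable {V : Type*} [Fintype V] {m : V → V → ℕ}

/-- The number of edges between two vertices of the unit `S` that count as inner edges of `S`: two
in a digon, and one for each pair of adjacent vertices in a triangle or in a diamond. The third
edge of a triple edge and the second edge on the double side of a trumpet are not inner edges. -/
def inner (m : V → V → ℕ) (S : Finset V) (x y : V) : ℕ :=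
  min (m x y) (if S.card = 2 then 2 else 1)

open Classical in
/-- The number of edges between `x` and `y` that are not inner edges of a unit. -/
noncomputable def outer (m : V → V → ℕ) (x y : V) : ℕ :=
  m x y - if y ∈ unitOf m x then inner m (unitOf m x) x y else 0

open Classical in
/-- The vertices that are incident with an edge that is not an inner edge of a unit: all vertices
but the centres of the diamonds. -/
noncomputable def ports (m : V → V → ℕ) : Finset V := {x | ∑ y, outer m x y = 1}

lemma mem_ports {x : V} : x ∈ ports m ↔ ∑ y, outer m x y = 1 := by
  simp [ports]

open Classical in
lemma inner_add_outer (x y : V) :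
    (if y ∈ unitOf m x then inner m (unitOf m x) x y else 0) + outer m x y = m x y := by
  rw [outer]
  have : inner m (unitOf m x) x y ≤ m x y := min_le_left _ _
  split_ifs <;> omega

namespace IsCubicWeight

variable (hm : IsCubicWeight m)
include hm

lemma unitOf_eq_iff {x y : V} : unitOf m y = unitOf m x ↔ y ∈ unitOf m x :=
  ⟨fun h => h ▸ mem_unitOf y, fun h => hm.unitOf_eq (hm.unitOf_mem x) h⟩

lemma inner_symm (S : Finset V) (x y : V) : inner m S x y = inner m S y x := by
  rw [inner, inner, hm.symm]

lemma outer_symm (x y : V) : outer m x y = outer m y x := by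
  rw [outer, outer]
  by_cases h : y ∈ unitOf m x
  · have h' := hm.unitOf_eq_iff.2 h
    rw [if_pos h, h', if_pos (mem_unitOf x), hm.inner_symm, hm.symm]
  · have h' : x ∉ unitOf m y := fun h' => h (hm.unitOf_eq_iff.1 (hm.unitOf_eq_iff.2 h').symm)
    rw [if_neg h, if_neg h', hm.symm]

lemma sum_inner_add_sum_outer (x : V) :
    ∑ y ∈ unitOf m x, inner m (unitOf m x) x y + ∑ y, outer m x y = 3 := by
  classical
  rw [← hm.sum x, ← Finset.sum_congr rfl (fun y _ => inner_add_outer (m := m) x y),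
    Finset.sum_add_distrib, Finset.sum_ite_mem, Finset.univ_inter]

lemma mem_ports_iff {S : Finset V} (hS : S ∈ units m) {x : V} (hx : x ∈ S) :
    x ∈ ports m ↔ ∑ y ∈ S, inner m S x y = 2 := by
  have := hm.sum_inner_add_sum_outer x
  rw [hm.unitOf_eq hS hx] at this
  rw [mem_ports]
  omega

lemma inner_digon {S : Finset V} (hS : S ∈ digons m) :
    ∃ x y, x ≠ y ∧ (∀ v, v ∈ S ↔ v = x ∨ v = y) ∧ inner m S x y = 2 := by
  classical
  have hc := hm.card_digon hS
  obtain ⟨x, y, rfl, h1, h2⟩ := mem_digons.1 hS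
  refine ⟨x, y, hm.ne (by omega), by simp, ?_⟩
  rw [inner, if_pos hc]
  omega

lemma inner_triangle {S : Finset V} (hS : S ∈ triangles m) {x y : V} (hx : x ∈ S) (hy : y ∈ S)
    (hxy : x ≠ y) : inner m S x y = 1 := by
  classical
  have hc := hm.card_triangle hS
  obtain ⟨a, b, c, rfl, h1, h2, h3, -⟩ := mem_triangles.1 hS
  rw [inner, if_neg (by omega)]
  have s1 := hm.symm a b
  have s2 := hm.symm a c
  have s3 := hm.symm b c
  simp only [Finset.mem_insert, Finset.mem_singleton] at hx hy
  rcases hx with rfl | rfl | rfl <;> rcases hy with rfl | rfl | rfl <;>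
    first | exact (hxy rfl).elim | omega

lemma inner_diamond {S : Finset V} (hS : S ∈ diamonds m) {x y : V} (h : m x y ≤ 1) :
    inner m S x y = m x y := by
  have hc := hm.card_diamond hS
  rw [inner, if_neg (by omega)]
  omega

lemma inner_self (S : Finset V) (x : V) : inner m S x x = 0 := by
  simp [inner, hm.self]

lemma digon_subset_ports {S : Finset V} (hS : S ∈ digons m) : S ⊆ ports m := by
  classical
  intro v hv
  rw [hm.mem_ports_iff (mem_units.2 (Or.inl hS)) hv]
  obtain ⟨x, y, hxy, hmem, h⟩ := hm.inner_digon hS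
  have hSe : S = {x, y} := by
    ext
    simp [hmem]
  nth_rewrite 1 [hSe]
  rw [Finset.sum_pair hxy]
  rcases (hmem v).1 hv with rfl | rfl
  · rw [hm.inner_self, h]
  · rw [hm.inner_self, hm.inner_symm, h]

lemma triangle_subset_ports {S : Finset V} (hS : S ∈ triangles m) : S ⊆ ports m := by
  classical
  intro v hv
  rw [hm.mem_ports_iff (mem_units.2 (Or.inr (Or.inl hS))) hv, ← Finset.add_sum_erase _ _ hv,
    hm.inner_self, Finset.sum_congr rfl (g := fun _ => 1)]
  · rw [Finset.sum_const, Finset.card_erase_of_mem hv, hm.card_triangle hS]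
    rfl
  · intro y hy
    exact hm.inner_triangle hS hv (Finset.mem_of_mem_erase hy) (Finset.ne_of_mem_erase hy).symm

lemma sum_diamond [DecidableEq V] {a b c d : V} (h : DiamondAt m a b c d) {M : Type*}
    [AddCommMonoid M] (f : V → M) :
    ∑ x ∈ {a, b, c, d}, f x = f a + (f b + (f c + f d)) := by
  obtain ⟨n1, n2, n3, n4, n5, n6⟩ := hm.diamondAt_ne h
  rw [Finset.sum_insert (by simp [n1, n2, n3]), Finset.sum_insert (by simp [n4, n5]),
    Finset.sum_pair n6]

lemma mem_ports_diamond [DecidableEq V] {a b c d : V} (h : DiamondAt m a b c d) :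
    a ∈ ports m ∧ b ∈ ports m ∧ c ∉ ports m ∧ d ∉ ports m := by
  have hS : ({a, b, c, d} : Finset V) ∈ diamonds m := mem_diamonds.2 ⟨a, b, c, d, rfl, h⟩
  have hU := mem_units.2 (Or.inr (Or.inr hS))
  have h' := h
  obtain ⟨h1, h2, h3, h4, h5, h6, h7⟩ := h
  rw [hm.mem_ports_iff hU (by simp), hm.mem_ports_iff hU (by simp), hm.mem_ports_iff hU (by simp),
    hm.mem_ports_iff hU (by simp)]
  simp only [hm.sum_diamond h', hm.inner_self]
  rw [hm.inner_symm _ b a, hm.inner_symm _ c a, hm.inner_symm _ c b, hm.inner_symm _ d a,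
    hm.inner_symm _ d b, hm.inner_symm _ d c, hm.inner_diamond hS (by omega),
    hm.inner_diamond hS (by omega), hm.inner_diamond hS (by omega),
    hm.inner_diamond hS (by omega), hm.inner_diamond hS (by omega),
    hm.inner_diamond hS (by omega)]
  omega

/-- A digon or a diamond has exactly two ports. -/
lemma exists_two_ports {S : Finset V} (hS : S ∈ units m) (hT : S ∉ triangles m) :
    ∃ a b, a ≠ b ∧ ∀ x, (x ∈ S ∧ x ∈ ports m) ↔ (x = a ∨ x = b) := by
  classical
  rcases mem_units.1 hS with h | h | h
  · obtain ⟨x, y, hxy, hmem, -⟩ := hm.inner_digon h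
    refine ⟨x, y, hxy, fun v => ?_⟩
    rw [← hmem]
    exact ⟨fun h => h.1, fun h' => ⟨h', hm.digon_subset_ports h h'⟩⟩
  · exact (hT h).elim
  · obtain ⟨a, b, c, d, rfl, hD⟩ := mem_diamonds.1 h
    obtain ⟨h1, h2, h3, h4⟩ := hm.mem_ports_diamond hD
    refine ⟨a, b, hD.1, fun v => ?_⟩
    simp only [Finset.mem_insert, Finset.mem_singleton]
    constructor
    · rintro ⟨rfl | rfl | rfl | rfl, h5⟩
      · simp
      · simp
      · exact (h3 h5).elim
      · exact (h4 h5).elim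
    · rintro (rfl | rfl) <;> simp [*]

lemma sum_outer_le (x : V) : ∑ y, outer m x y ≤ 1 := by
  classical
  have h := hm.sum_inner_add_sum_outer x
  suffices 2 ≤ ∑ y ∈ unitOf m x, inner m (unitOf m x) x y by omega
  have hx := mem_unitOf (m := m) x
  have hU := hm.unitOf_mem x
  by_cases hp : x ∈ ports m
  · rw [(hm.mem_ports_iff hU hx).1 hp]
  rcases mem_units.1 hU with h | h | h
  · exact (hp (hm.digon_subset_ports h hx)).elim
  · exact (hp (hm.triangle_subset_ports h hx)).elim
  · obtain ⟨a, b, c, d, hS, hD⟩ := mem_diamonds.1 h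
    obtain ⟨h1, h2, h3, h4⟩ := hm.mem_ports_diamond hD
    have key : 2 ≤ inner m (unitOf m x) x a + inner m (unitOf m x) x b := by
      have hx' := hx
      obtain ⟨g1, g2, g3, g4, g5, g6, g7⟩ := hD
      have s1 := hm.symm a c
      have s2 := hm.symm a d
      have s3 := hm.symm b c
      have s4 := hm.symm b d
      simp only [hS, Finset.mem_insert, Finset.mem_singleton] at hx'
      rcases hx' with rfl | rfl | rfl | rfl
      · exact (hp h1).elim
      · exact (hp h2).elim
      · rw [hm.inner_diamond h (by omega), hm.inner_diamond h (by omega)]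
        omega
      · rw [hm.inner_diamond h (by omega), hm.inner_diamond h (by omega)]
        omega
    refine key.trans ?_
    rw [← Finset.sum_pair hD.1]
    refine Finset.sum_le_sum_of_subset ?_
    rw [hS]
    intro v
    simp only [Finset.mem_insert, Finset.mem_singleton]
    tauto

/-- The edges that are not inner edges of a unit match the ports. -/
lemma exists_outer_matching : ∃ e : V → V, IsSignedMatching (ports m) e (fun _ => -1) ∧
    ∀ x y, outer m x y ≠ 0 → x ∈ ports m ∧ y = e x := by
  classical
  have huniq : ∀ x y z, outer m x y ≠ 0 → outer m x z ≠ 0 → y = z := by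
    intro x y z h1 h2
    by_contra h3
    have := Finset.sum_le_sum_of_subset (f := outer m x) (Finset.subset_univ {y, z})
    rw [Finset.sum_pair h3] at this
    have := hm.sum_outer_le x
    omega
  have hport : ∀ x y, outer m x y ≠ 0 → x ∈ ports m := by
    intro x y h
    have := Finset.single_le_sum (f := outer m x) (fun _ _ => Nat.zero_le _) (Finset.mem_univ y)
    have := hm.sum_outer_le x
    rw [mem_ports]
    omega
  have hex : ∀ x, ∃ y, x ∈ ports m → outer m x y ≠ 0 := by
    intro x
    by_cases hx : x ∈ ports m
    · rw [mem_ports] at hx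
      obtain ⟨y, -, hy⟩ := Finset.exists_ne_zero_of_sum_ne_zero (hx.trans_ne one_ne_zero)
      exact ⟨y, fun _ => hy⟩
    · exact ⟨x, fun h => (hx h).elim⟩
  choose e he using hex
  have he' : ∀ x ∈ ports m, outer m (e x) x ≠ 0 := fun x hx => hm.outer_symm x (e x) ▸ he x hx
  refine ⟨e, ⟨fun x hx => hport _ _ (he' x hx), fun x hx h => ?_, fun x hx => ?_,
    fun _ _ => rfl⟩, fun x y h => ⟨hport x y h, huniq x y _ h (he x (hport x y h))⟩⟩
  · have h1 := he x hx
    rw [h, outer, hm.self] at h1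
    omega
  · exact huniq (e x) _ _ (he _ (hport _ _ (he' x hx))) (he' x hx)

open Classical in
/-- The two ports of each digon and of each diamond are paired. -/
lemma exists_inner_pairing : ∃ t : V → V,
    (∀ ρ : V → ℤˣ, (∀ x y, unitOf m x = unitOf m y → ρ x = ρ y) →
      IsSignedMatching {x ∈ ports m | unitOf m x ∉ triangles m} t ρ) ∧
    ∀ x ∈ ports m, unitOf m x ∉ triangles m → unitOf m (t x) = unitOf m x ∧
      ∀ z ∈ ports m, unitOf m z = unitOf m x → z = x ∨ z = t x := by
  have hex : ∀ x, ∃ y, x ∈ ports m → unitOf m x ∉ triangles m →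
      y ∈ ports m ∧ y ≠ x ∧ unitOf m y = unitOf m x ∧
      ∀ z ∈ ports m, unitOf m z = unitOf m x → z = x ∨ z = y := by
    intro x
    by_cases h : x ∈ ports m ∧ unitOf m x ∉ triangles m
    · obtain ⟨a, b, hab, hmem⟩ := hm.exists_two_ports (hm.unitOf_mem x) h.2
      have ha := (hmem a).2 (Or.inl rfl)
      have hb := (hmem b).2 (Or.inr rfl)
      rcases (hmem x).1 ⟨mem_unitOf x, h.1⟩ with hx | hx
      · refine ⟨b, fun _ _ => ⟨hb.2, hx ▸ hab.symm, hm.unitOf_eq_iff.2 hb.1, fun z hz hz' => ?_⟩⟩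
        rw [hx]
        exact (hmem z).1 ⟨hm.unitOf_eq_iff.1 hz', hz⟩
      · refine ⟨a, fun _ _ => ⟨ha.2, hx ▸ hab, hm.unitOf_eq_iff.2 ha.1, fun z hz hz' => ?_⟩⟩
        rw [hx]
        exact ((hmem z).1 ⟨hm.unitOf_eq_iff.1 hz', hz⟩).symm
    · exact ⟨x, fun h1 h2 => (h ⟨h1, h2⟩).elim⟩
  choose t ht using hex
  refine ⟨t, fun ρ hρ => ⟨?_, ?_, ?_, ?_⟩, fun x hx hx' => (ht x hx hx').2.2⟩ <;>
    intro x hx <;> rw [Finset.mem_filter] at hx <;> obtain ⟨h1, h2, h3, h4⟩ := ht x hx.1 hx.2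
  · rw [Finset.mem_filter, h3]
    exact ⟨h1, hx.2⟩
  · exact h2
  · obtain ⟨g1, g2, g3, g4⟩ := ht (t x) h1 (h3.symm ▸ hx.2)
    rcases h4 _ g1 (g3.trans h3) with h | h
    · exact h
    · exact (g2 h).elim
  · exact hρ _ _ h3

open Classical in
/-- The colouring of the ports: outer edges get different colours, and so do the two ports of a
digon or of a diamond from `F`; the ports of the other diamonds get equal colours. If the outer
edges and the pairs of ports close up to a cycle, then by connectivity this cycle runs through all
ports. In this case the constraint of one pair is dropped and recovered from the parity of the
number of diamonds outside `F`. -/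
lemma exists_port_coloring {F : Finset (Finset V)} (hF : F ⊆ diamonds m)
    (heven : Even ((diamonds m).card + F.card)) : ∃ τ : V → ℤˣ,
      (∀ x y, outer m x y ≠ 0 → τ y = - τ x) ∧
      (∀ S ∈ units m, S ∉ triangles m → ∀ x ∈ S, ∀ y ∈ S, x ∈ ports m → y ∈ ports m → x ≠ y →
        τ y = (if S.card = 2 ∨ S ∈ F then -1 else 1) * τ x) ∧
      (∀ T ∈ triangles m, ∃ x ∈ T, ∃ y ∈ T, τ x ≠ τ y) ∧
      |∑ T ∈ triangles m, ∑ x ∈ T, (τ x : ℤ)| ≤ 2 := by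
  obtain ⟨e, he, hout⟩ := hm.exists_outer_matching
  obtain ⟨t, ht, hpair⟩ := hm.exists_inner_pairing
  set ρ : V → ℤˣ := fun x => if (unitOf m x).card = 2 ∨ unitOf m x ∈ F then -1 else 1 with hρ
  set Y : Finset V := {x ∈ ports m | unitOf m x ∉ triangles m} with hY
  have htY : IsSignedMatching Y t ρ := ht ρ (fun x y h => by simp only [hρ, h])
  have hYp : Y ⊆ ports m := Finset.filter_subset _ _
  -- from the matching `t` back to the units
  have hback : ∀ τ : V → ℤˣ, (∀ x ∈ Y, τ (t x) = ρ x * τ x) →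
      ∀ S ∈ units m, S ∉ triangles m → ∀ x ∈ S, ∀ y ∈ S, x ∈ ports m → y ∈ ports m → x ≠ y →
        τ y = (if S.card = 2 ∨ S ∈ F then -1 else 1) * τ x := by
    intro τ h S hS hS' x hx y hy hxp hyp hxy
    have hux := hm.unitOf_eq hS hx
    have huy := hm.unitOf_eq hS hy
    rcases (hpair x hxp (hux.symm ▸ hS')).2 y hyp (huy.trans hux.symm) with rfl | rfl
    · exact (hxy rfl).elim
    · rw [h x (Finset.mem_filter.2 ⟨hxp, hux.symm ▸ hS'⟩)]
      simp only [hρ, hux]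
  have hsub : ∀ T ∈ triangles m, T ⊆ ports m \ Y := by
    intro T hT x hx
    rw [Finset.mem_sdiff, hY, Finset.mem_filter,
      hm.unitOf_eq (mem_units.2 (Or.inr (Or.inl hT))) hx]
    exact ⟨hm.triangle_subset_ports hT hx, fun h => h.2 hT⟩
  have hdisj : ∀ S ∈ triangles m, ∀ T ∈ triangles m, S ≠ T → Disjoint S T := fun S hS T hT =>
    hm.units_disjoint (mem_units.2 (Or.inr (Or.inl hS))) (mem_units.2 (Or.inr (Or.inl hT)))
  by_cases hring : ∀ Z ⊆ Y, (∀ x ∈ Z, e x ∈ Z) → (∀ x ∈ Z, t x ∈ Z) → Z = ∅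
  · obtain ⟨τ, h1, h2, h3, h4⟩ := he.exists_coloring_two htY hYp hring (triangles m) hsub
      (fun T hT => hm.card_triangle hT) hdisj
    refine ⟨τ, ?_, hback τ h2, h3, ?_⟩
    · intro x y hxy
      obtain ⟨hx, rfl⟩ := hout x y hxy
      rw [h1 x hx, neg_one_mul]
    · rw [← Finset.sum_biUnion (fun S hS T hT h => hdisj S hS T hT h)]
      convert h4 using 3
      ext x
      simp only [Finset.mem_biUnion]
      constructor
      · rintro ⟨T, hT, hx⟩
        exact hsub T hT hx
      · intro hx
        rw [Finset.mem_sdiff, hY, Finset.mem_filter] at hx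
        refine ⟨unitOf m x, ?_, mem_unitOf x⟩
        by_contra h
        exact hx.2 ⟨hx.1, h⟩
  push Not at hring
  obtain ⟨Z₀, hZY₀, hZe₀, hZt₀, hZ₀⟩ := hring
  -- by connectivity a closed set of ports contains all ports
  have hclosed : ∀ Z ⊆ Y, (∀ x ∈ Z, e x ∈ Z) → (∀ x ∈ Z, t x ∈ Z) → Z.Nonempty →
      ∀ v, unitOf m v ∉ triangles m ∧ (v ∈ ports m → v ∈ Z) := by
    intro Z hZY hZe hZt hZ
    have hZmem : ∀ v ∈ ports m, (∃ z ∈ Z, unitOf m v = unitOf m z) → v ∈ Z := by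
      rintro v hv ⟨z, hz, hvz⟩
      have hzY := Finset.mem_filter.1 (hZY hz)
      rcases (hpair z hzY.1 hzY.2).2 v hv hvz with rfl | rfl
      exacts [hz, hZt z hz]
    have hall := hm.conn {v | ∃ z ∈ Z, unitOf m v = unitOf m z} ?_ ?_
    · intro v
      have hv := hall v
      rw [Finset.mem_filter] at hv
      refine ⟨?_, fun hvp => hZmem v hvp hv.2⟩
      obtain ⟨z, hz, hvz⟩ := hv.2
      rw [hvz]
      exact (Finset.mem_filter.1 (hZY hz)).2
    · obtain ⟨z, hz⟩ := hZ
      exact ⟨z, Finset.mem_filter.2 ⟨Finset.mem_univ _, z, hz, rfl⟩⟩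
    · intro v hv w hvw
      simp only [Finset.mem_filter, Finset.mem_univ, true_and] at hv ⊢
      by_cases hw : w ∈ unitOf m v
      · rwa [hm.unitOf_eq_iff.2 hw]
      · have hne : outer m v w ≠ 0 := by
          rw [outer, if_neg hw]
          omega
        obtain ⟨hvp, rfl⟩ := hout v w hne
        exact ⟨e v, hZe v (hZmem v hvp hv), rfl⟩
  have hall := hclosed Z₀ hZY₀ hZe₀ hZt₀ hZ₀
  have htri : triangles m = ∅ := by
    refine Finset.eq_empty_of_forall_notMem fun T hT => ?_
    obtain ⟨x, hx⟩ := Finset.card_pos.1 (hm.card_triangle hT ▸ three_pos)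
    refine (hall x).1 ?_
    rwa [hm.unitOf_eq (mem_units.2 (Or.inr (Or.inl hT))) hx]
  obtain ⟨a, ha⟩ := hZ₀
  have haY := hZY₀ ha
  obtain ⟨τ, h1, h2, -, -⟩ := he.exists_coloring_two (htY.sdiff haY)
    (Finset.sdiff_subset.trans hYp) (by
      intro Z hZ hZe hZt
      by_contra hne
      have := (hclosed Z (hZ.trans Finset.sdiff_subset) hZe hZt
        (Finset.nonempty_iff_ne_empty.2 hne) a).2 (hYp haY)
      simpa using hZ this) (triangles m) (by simp [htri]) (by simp [htri]) (by simp [htri])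
  have htriU : ∀ S, S ∉ triangles m := by simp [htri]
  -- the sum of the colours of the ports vanishes
  have hzero : ∑ x ∈ ports m, (τ x : ℤ) = 0 := by
    have : ∑ x ∈ ports m, (τ x : ℤ) = ∑ x ∈ ports m, (τ (e x) : ℤ) :=
      Finset.sum_nbij' e e he.mem he.mem he.invol he.invol fun x hx => by rw [he.invol x hx]
    rw [Finset.sum_congr rfl (g := fun x => -(τ x : ℤ)) (s₁ := ports m)
      (f := fun x => (τ (e x) : ℤ)) (fun x hx => by rw [h1 x hx, neg_one_mul, Units.val_neg]),
      Finset.sum_neg_distrib] at this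
    omega
  have hunit : ∀ x ∈ Y, ∑ y ∈ unitOf m x, (if y ∈ ports m then (τ y : ℤ) else 0) =
      τ x + τ (t x) := by
    intro x hx
    have hx' := Finset.mem_filter.1 hx
    rw [← Finset.sum_pair (f := fun y => (τ y : ℤ)) (htY.ne x hx).symm, ← Finset.sum_filter]
    refine Finset.sum_congr ?_ fun _ _ => rfl
    ext y
    simp only [Finset.mem_filter, Finset.mem_insert, Finset.mem_singleton]
    constructor
    · rintro ⟨hy, hyp⟩
      exact (hpair x hx'.1 hx'.2).2 y hyp (hm.unitOf_eq_iff.2 hy)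
    · rintro (rfl | rfl)
      · exact ⟨mem_unitOf _, hx'.1⟩
      · exact ⟨hm.unitOf_eq_iff.1 (hpair x hx'.1 hx'.2).1, hYp (htY.mem x hx)⟩
  -- modulo four, the colours of two ports add up to `0` if they differ, and to `2` if they agree
  have hdvd : ∀ S ∈ (units m).erase (unitOf m a), (4 : ℤ) ∣
      ∑ y ∈ S, (if y ∈ ports m then (τ y : ℤ) else 0) -
        (if S.card = 2 ∨ S ∈ F then 0 else 2) := by
    intro S hS
    obtain ⟨hSa, hS⟩ := Finset.mem_erase.1 hS
    obtain ⟨b, c, hbc, hmem⟩ := hm.exists_two_ports hS (htriU S)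
    obtain ⟨hbS, hbp⟩ := (hmem b).2 (Or.inl rfl)
    have hub := hm.unitOf_eq hS hbS
    have hbY : b ∈ Y := Finset.mem_filter.2 ⟨hbp, htriU _⟩
    have hb := h2 b (by
      simp only [Finset.mem_sdiff, Finset.mem_insert, Finset.mem_singleton, hbY, true_and]
      rintro (rfl | rfl)
      · exact hSa hub.symm
      · exact hSa (hub.symm.trans (hpair a (hYp haY) (htriU _)).1))
    have hsum := hunit b hbY
    rw [hub] at hsum
    rw [hsum, hb]
    simp only [hρ, hub]
    rcases Int.units_eq_one_or (τ b) with h | h <;> rw [h] <;> split_ifs <;> decide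
  have hcount : (4 : ℤ) ∣ ∑ S ∈ units m, (if S.card = 2 ∨ S ∈ F then 0 else 2) := by
    rw [hm.sum_units_eq, htri, Finset.sum_empty, Finset.sum_eq_zero, zero_add, zero_add,
      Finset.sum_congr rfl (g := fun S => if S ∈ F then 0 else 2)]
    · rw [← Finset.sum_sdiff hF, Finset.sum_eq_zero (s := F) (fun S hS => if_pos hS), add_zero,
        Finset.sum_congr rfl (g := fun _ => (2 : ℤ)) (fun S hS =>
          if_neg (Finset.mem_sdiff.1 hS).2), Finset.sum_const, Finset.card_sdiff_of_subset hF]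
      obtain ⟨k, hk⟩ := heven
      have := Finset.card_le_card hF
      refine ⟨k - F.card, ?_⟩
      rw [nsmul_eq_mul, Nat.cast_sub this]
      omega
    · intro S hS
      have := hm.card_diamond hS
      simp [this]
    · intro S hS
      simp [hm.card_digon hS]
  have hua := hm.unitOf_mem a
  have hdvd_a : (4 : ℤ) ∣ ∑ y ∈ unitOf m a, (if y ∈ ports m then (τ y : ℤ) else 0) -
        (if (unitOf m a).card = 2 ∨ unitOf m a ∈ F then 0 else 2) := by
    have hsum := hm.sum_units (fun y => if y ∈ ports m then (τ y : ℤ) else 0)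
    rw [Finset.sum_ite_mem, Finset.univ_inter, hzero] at hsum
    have htot : (4 : ℤ) ∣ ∑ S ∈ units m, (∑ y ∈ S, (if y ∈ ports m then (τ y : ℤ) else 0) -
        (if S.card = 2 ∨ S ∈ F then 0 else 2)) := by
      rw [Finset.sum_sub_distrib, hsum, zero_sub, dvd_neg]
      exact hcount
    rw [← Finset.add_sum_erase _ _ hua] at htot
    exact (dvd_add_left (Finset.dvd_sum hdvd)).1 htot
  have hta : τ (t a) = ρ a * τ a := by
    rw [hunit a haY] at hdvd_a
    revert hdvd_a
    simp only [hρ]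
    rcases Int.units_eq_one_or (τ a) with h | h <;> rw [h] <;>
      rcases Int.units_eq_one_or (τ (t a)) with h' | h' <;> rw [h'] <;> split_ifs <;> decide
  refine ⟨τ, ?_, hback τ ?_, by simp [htri], by simp [htri]⟩
  · intro x y hxy
    obtain ⟨hx, rfl⟩ := hout x y hxy
    rw [h1 x hx, neg_one_mul]
  · intro x hx
    by_cases hxa : x = a
    · rw [hxa, hta]
    by_cases hxb : x = t a
    · rw [hxb, htY.invol a haY, hta, htY.sign a haY, ← mul_assoc, Int.units_mul_self, one_mul]
    exact h2 x (by simp [hx, hxa, hxb])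

end IsCubicWeight

end Ports

/-! ### Counting monochromatic edges and gluing the colourings of the units -/

open Classical in
/-- Twice the number of monochromatic edges of the colouring `σ`: the number of ordered pairs of
vertices of the same colour, counted with multiplicity. -/
noncomputable def monoSum {V : Type*} [Fintype V] (m : V → V → ℕ) (σ : V → ℤˣ) : ℕ :=
  ∑ x, ∑ y, if σ x = σ y then m x y else 0

section MonoSum

/-- The number of ends of edges inside a set of vertices is even. -/
lemma even_sum_sum {V : Type*} {m : V → V → ℕ} (hs : ∀ x y, m x y = m y x) (h0 : ∀ x, m x x = 0)
    (A : Finset V) :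
    Even (∑ x ∈ A, ∑ y ∈ A, m x y) := by
  classical
  induction A using Finset.induction_on with
  | empty => simp
  | insert a A ha ih =>
    rw [Finset.sum_insert ha, Finset.sum_insert ha, h0, zero_add,
      Finset.sum_congr rfl (fun x _ => Finset.sum_insert ha), Finset.sum_add_distrib,
      Finset.sum_congr rfl (fun x _ => hs x a), ← add_assoc]
    exact (Even.add_self _).add ih

variable {V : Type*} [Fintype V] {m : V → V → ℕ}

namespace IsCubicWeight

variable (hm : IsCubicWeight m)
include hm

/-- With `p` and `q` the numbers of edges inside the two colour classes `B` and `W`, counting the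
edges between the classes from both sides gives `3|B| - 2p = 3|W| - 2q`. -/
lemma exists_class_edges (σ : V → ℤˣ) : ∃ p q : ℤ, (monoSum m σ : ℤ) = 2 * (p + q) ∧
    3 * ∑ x, (σ x : ℤ) = 2 * (p - q) := by
  classical
  obtain ⟨p, hp⟩ := even_sum_sum hm.symm hm.self {x | σ x = 1}
  obtain ⟨q, hq⟩ := even_sum_sum hm.symm hm.self {x | ¬ σ x = 1}
  simp only [Finset.sum_filter] at hp hq
  refine ⟨p, q, ?_, ?_⟩
  · have : (monoSum m σ : ℤ) = ((p + p + (q + q) : ℕ) : ℤ) := by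
      rw [← hp, ← hq, monoSum, ← Finset.sum_add_distrib]
      congr 1
      refine Finset.sum_congr rfl fun x _ => ?_
      rcases Int.units_eq_one_or (σ x) with hx | hx
      · simp [hx, eq_comm]
      · have h1 : ∀ y, ((-1 : ℤˣ) = σ y ↔ ¬ σ y = 1) := fun y => by
          rcases Int.units_eq_one_or (σ y) with h | h <;> rw [h] <;> decide
        simp only [hx, h1]
        simp
    rw [this]
    push_cast
    ring
  · have h1 : 3 * ∑ x, (σ x : ℤ) = ∑ x, ∑ y, (σ x : ℤ) * m x y := by
      rw [Finset.mul_sum]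
      refine Finset.sum_congr rfl fun x _ => ?_
      rw [← Finset.mul_sum, ← Nat.cast_sum, hm.sum]
      push_cast
      ring
    have h2 : ∑ x, ∑ y, (σ x : ℤ) * m x y = ∑ x, ∑ y, (σ y : ℤ) * m x y := by
      rw [Finset.sum_comm]
      refine Finset.sum_congr rfl fun x _ => Finset.sum_congr rfl fun y _ => ?_
      rw [hm.symm]
    have h3 : ∑ x, ∑ y, (σ x : ℤ) * m x y + ∑ x, ∑ y, (σ y : ℤ) * m x y =
        2 * (((p + p : ℕ) : ℤ) - ((q + q : ℕ) : ℤ)) := by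
      rw [← hp, ← hq]
      push_cast
      rw [← Finset.sum_sub_distrib, Finset.mul_sum, ← Finset.sum_add_distrib]
      refine Finset.sum_congr rfl fun x _ => ?_
      rw [← Finset.sum_add_distrib]
      rcases Int.units_eq_one_or (σ x) with hx | hx
      · simp only [hx, if_true, not_true, if_false, sub_zero]
        push_cast
        rw [Finset.mul_sum]
        refine Finset.sum_congr rfl fun y _ => ?_
        rcases Int.units_eq_one_or (σ y) with hy | hy <;> simp [hy]
        ring
      · have h4 : ¬ (-1 : ℤˣ) = 1 := by decide
        simp only [hx, h4, if_false, not_false_eq_true, if_true, zero_sub]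
        push_cast
        rw [mul_neg, Finset.mul_sum, ← Finset.sum_neg_distrib]
        refine Finset.sum_congr rfl fun y _ => ?_
        rcases Int.units_eq_one_or (σ y) with hy | hy <;> simp [hy]
        ring
    rw [← h2] at h3
    push_cast at h3
    linarith

lemma even_card : Even (Fintype.card V) := by
  have h := even_sum_sum hm.symm hm.self Finset.univ
  simp only [hm.sum, Finset.sum_const, Finset.card_univ, smul_eq_mul] at h
  rw [Nat.even_mul] at h
  exact h.resolve_right (by decide)

lemma even_card_triangles : Even (triangles m).card := by
  have h := hm.even_card
  rw [hm.card_eq] at h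
  rw [Nat.even_iff] at h ⊢
  omega

open Classical in
lemma monoSum_units (σ : V → ℤˣ) : ∑ S ∈ units m, ∑ x ∈ S, ∑ y ∈ S,
    (if σ x = σ y then inner m S x y else 0) +
      ∑ x, ∑ y, (if σ x = σ y then outer m x y else 0) = monoSum m σ := by
  have h1 : ∑ S ∈ units m, ∑ x ∈ S, ∑ y ∈ S, (if σ x = σ y then inner m S x y else 0) =
      ∑ S ∈ units m, ∑ x ∈ S, ∑ y ∈ unitOf m x,
        (if σ x = σ y then inner m (unitOf m x) x y else 0) := by
    refine Finset.sum_congr rfl fun S hS => Finset.sum_congr rfl fun x hx => ?_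
    rw [hm.unitOf_eq hS hx]
  rw [h1, hm.sum_units, ← Finset.sum_add_distrib, monoSum]
  refine Finset.sum_congr rfl fun x _ => ?_
  rw [← Finset.univ_inter (unitOf m x), ← Finset.sum_ite_mem, ← Finset.sum_add_distrib]
  simp only [Finset.univ_inter]
  refine Finset.sum_congr rfl fun y _ => ?_
  rw [← inner_add_outer (m := m) x y]
  split_ifs <;> simp

open Classical in
/-- Two of any three pairwise adjacent vertices have the same colour. -/
lemma two_le_of_adj {S : Finset V} (σ : V → ℤˣ) {a b c : V} (ha : a ∈ S) (hb : b ∈ S) (hc : c ∈ S)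
    (hab : 0 < inner m S a b) (hac : 0 < inner m S a c) (hbc : 0 < inner m S b c) :
    2 ≤ ∑ x ∈ S, ∑ y ∈ S, (if σ x = σ y then inner m S x y else 0) := by
  have key : ∀ x y, x ∈ S → y ∈ S → 0 < inner m S x y → σ x = σ y →
      2 ≤ ∑ x ∈ S, ∑ y ∈ S, (if σ x = σ y then inner m S x y else 0) := by
    intro x y hx hy hxy h
    have hne : x ≠ y := by
      rintro rfl
      rw [hm.inner_self] at hxy
      exact lt_irrefl _ hxy
    have hsub : ({x, y} : Finset V) ⊆ S := by
      intro v hv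
      simp only [Finset.mem_insert, Finset.mem_singleton] at hv
      rcases hv with rfl | rfl <;> assumption
    have h1 := Finset.sum_le_sum_of_subset
      (f := fun x => ∑ y ∈ S, (if σ x = σ y then inner m S x y else 0)) hsub
    rw [Finset.sum_pair hne] at h1
    have h2 := Finset.single_le_sum
      (f := fun v => (if σ x = σ v then inner m S x v else 0)) (fun _ _ => Nat.zero_le _) hy
    have h3 := Finset.single_le_sum
      (f := fun v => (if σ y = σ v then inner m S y v else 0)) (fun _ _ => Nat.zero_le _) hx
    rw [if_pos h] at h2
    rw [if_pos h.symm, hm.inner_symm] at h3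
    omega
  rcases Int.units_eq_one_or (σ a) with h1 | h1 <;>
    rcases Int.units_eq_one_or (σ b) with h2 | h2 <;>
    rcases Int.units_eq_one_or (σ c) with h3 | h3 <;>
    first
    | exact key a b ha hb hab (h1.trans h2.symm)
    | exact key a c ha hc hac (h1.trans h3.symm)
    | exact key b c hb hc hbc (h2.trans h3.symm)

/-- Each triangle outside diamonds and each diamond has a monochromatic edge. -/
lemma le_monoSum (σ : V → ℤˣ) :
    2 * ((triangles m).card + (diamonds m).card) ≤ monoSum m σ := by
  classical
  rw [← hm.monoSum_units, hm.sum_units_eq]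
  have h1 : (triangles m).card • 2 ≤ ∑ S ∈ triangles m, ∑ x ∈ S, ∑ y ∈ S,
      (if σ x = σ y then inner m S x y else 0) := by
    refine Finset.card_nsmul_le_sum _ _ _ fun S hS => ?_
    obtain ⟨a, b, c, hab, hac, hbc, hSe⟩ := Finset.card_eq_three.1 (hm.card_triangle hS)
    have ha : a ∈ S := by simp [hSe]
    have hb : b ∈ S := by simp [hSe]
    have hc : c ∈ S := by simp [hSe]
    refine hm.two_le_of_adj σ ha hb hc ?_ ?_ ?_ <;> rw [hm.inner_triangle hS] <;>
      first | assumption | exact one_pos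
  have h2 : (diamonds m).card • 2 ≤ ∑ S ∈ diamonds m, ∑ x ∈ S, ∑ y ∈ S,
      (if σ x = σ y then inner m S x y else 0) := by
    refine Finset.card_nsmul_le_sum _ _ _ fun S hS => ?_
    obtain ⟨a, b, c, d, hSe, g1, g2, g3, g4, g5, g6, g7⟩ := mem_diamonds.1 hS
    have ha : a ∈ S := by simp [hSe]
    have hb : c ∈ S := by simp [hSe]
    have hc : d ∈ S := by simp [hSe]
    refine hm.two_le_of_adj σ ha hb hc ?_ ?_ ?_ <;> rw [hm.inner_diamond hS] <;> omega
  simp only [smul_eq_mul] at h1 h2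
  omega

open Classical in
/-- A colouring of the ports extends to every single unit: no vertex gets two neighbours of its own
colour inside the unit, and digons and diamonds are balanced. -/
lemma exists_unit_coloring {F : Finset (Finset V)} (hF : F ⊆ diamonds m) {τ : V → ℤˣ}
    (hpair : ∀ S ∈ units m, S ∉ triangles m → ∀ x ∈ S, ∀ y ∈ S, x ∈ ports m → y ∈ ports m →
      x ≠ y → τ y = (if S.card = 2 ∨ S ∈ F then -1 else 1) * τ x)
    (htri : ∀ T ∈ triangles m, ∃ x ∈ T, ∃ y ∈ T, τ x ≠ τ y) {S : Finset V} (hS : S ∈ units m) :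
    ∃ f : V → ℤˣ, (∀ x ∈ S, x ∈ ports m → f x = τ x) ∧
      (∀ x ∈ S, ∀ y ∈ S, ∀ z ∈ S, 0 < m x y → 0 < m y z → x ≠ z → f x = f y → f y ≠ f z) ∧
      (S ∉ triangles m → ∑ x ∈ S, (f x : ℤ) = 0) ∧
      ∑ x ∈ S, ∑ y ∈ S, (if f x = f y then inner m S x y else 0) =
        if S.card = 2 then 0 else if S ∈ F then 4 else 2 := by
  have hneg' : ∀ u : ℤˣ, ¬ u = -u ∧ ¬ -u = u := by decide
  rcases mem_units.1 hS with h | h | h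
  · have hcard := hm.card_digon h
    have hp := hm.digon_subset_ports h
    have hT : S ∉ triangles m := fun hT => by
      have := hm.card_triangle hT
      omega
    obtain ⟨x, y, hxy, hmem, -⟩ := hm.inner_digon h
    have hSe : S = {x, y} := by
      ext
      simp [hmem]
    have hx : x ∈ S := by simp [hSe]
    have hy : y ∈ S := by simp [hSe]
    have hτ := hpair S hS hT x hx y hy (hp hx) (hp hy) hxy
    rw [if_pos (Or.inl hcard), neg_one_mul] at hτ
    refine ⟨τ, fun _ _ _ => rfl, ?_, fun _ => ?_, ?_⟩
    · intro u hu v hv w hw huv hvw huw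
      have h1 := hm.ne huv
      have h2 := hm.ne hvw
      rw [hmem] at hu hv hw
      rcases hu with rfl | rfl <;> rcases hv with rfl | rfl <;> rcases hw with rfl | rfl <;>
        contradiction
    · rw [hSe, Finset.sum_pair hxy, hτ]
      simp
    · rw [if_pos hcard]
      refine Finset.sum_eq_zero fun u hu => Finset.sum_eq_zero fun v hv => ?_
      rw [hmem] at hu hv
      rcases hu with rfl | rfl <;> rcases hv with rfl | rfl <;>
        simp [hm.inner_self, hτ, hneg']
  · have hcard := hm.card_triangle h
    have hSF : S ∉ F := fun hSF => by
      have := hm.card_diamond (hF hSF)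
      omega
    refine ⟨τ, fun _ _ _ => rfl, ?_, fun hT => (hT h).elim, ?_⟩
    · intro x hx y hy z hz hxy hyz hxz h1 h2
      have hSe : {x, y, z} = S := by
        refine Finset.eq_of_subset_of_card_le ?_ ?_
        · intro v hv
          simp only [Finset.mem_insert, Finset.mem_singleton] at hv
          rcases hv with rfl | rfl | rfl <;> assumption
        · rw [hcard, Finset.card_eq_three.2 ⟨x, y, z, hm.ne hxy, hxz, hm.ne hyz, rfl⟩]
      obtain ⟨u, hu, v, hv, huv⟩ := htri S h
      rw [← hSe] at hu hv
      simp only [Finset.mem_insert, Finset.mem_singleton] at hu hv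
      apply huv
      rcases hu with rfl | rfl | rfl <;> rcases hv with rfl | rfl | rfl <;> simp [h1, h2]
    · rw [if_neg (by omega), if_neg hSF]
      obtain ⟨a, b, c, hab, hac, hbc, hSe⟩ := Finset.card_eq_three.1 hcard
      have ha : a ∈ S := by simp [hSe]
      have hb : b ∈ S := by simp [hSe]
      have hc : c ∈ S := by simp [hSe]
      have hsum : ∀ g : V → ℕ, ∑ x ∈ S, g x = g a + (g b + g c) := by
        intro g
        rw [hSe, Finset.sum_insert (by simp [hab, hac]), Finset.sum_pair hbc]
      simp only [hsum, hm.inner_self, hm.inner_triangle h ha hb hab,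
        hm.inner_triangle h hb ha hab.symm, hm.inner_triangle h ha hc hac,
        hm.inner_triangle h hc ha hac.symm, hm.inner_triangle h hb hc hbc,
        hm.inner_triangle h hc hb hbc.symm]
      have hnc : ¬ (τ a = τ b ∧ τ a = τ c) := by
        rintro ⟨h1, h2⟩
        obtain ⟨u, hu, v, hv, huv⟩ := htri S h
        rw [hSe] at hu hv
        simp only [Finset.mem_insert, Finset.mem_singleton] at hu hv
        apply huv
        rcases hu with rfl | rfl | rfl <;> rcases hv with rfl | rfl | rfl <;> simp [← h1, ← h2]
      generalize τ a = u at hnc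
      generalize τ b = v at hnc
      generalize τ c = w at hnc
      revert u v w
      decide
  · have hcard := hm.card_diamond h
    have hT : S ∉ triangles m := fun hT => by
      have := hm.card_triangle hT
      omega
    obtain ⟨a, b, c, d, hSe, hD⟩ := mem_diamonds.1 h
    obtain ⟨n1, n2, n3, n4, n5, n6⟩ := hm.diamondAt_ne hD
    obtain ⟨p1, p2, p3, p4⟩ := hm.mem_ports_diamond hD
    have hmem : ∀ v, v ∈ S ↔ v = a ∨ v = b ∨ v = c ∨ v = d := by simp [hSe]
    have hτ := hpair S hS hT a (by simp [hSe]) b (by simp [hSe]) p1 p2 n1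
    have hsum : ∀ (M : Type) [AddCommMonoid M] (g : V → M),
        ∑ x ∈ S, g x = g a + (g b + (g c + g d)) := by
      intro M _ g
      rw [hSe, hm.sum_diamond hD]
    obtain ⟨-, g2, g3, g4, g5, g6, g7⟩ := hD
    have hinner : ∀ x y k, k ≤ 1 → m x y = k → inner m S x y = k ∧ inner m S y x = k := by
      rintro x y k hk rfl
      rw [hm.inner_symm S y x, hm.inner_diamond h hk]
      exact ⟨rfl, rfl⟩
    obtain ⟨i2, i2'⟩ := hinner _ _ _ zero_le_one g2
    obtain ⟨i3, i3'⟩ := hinner _ _ _ le_rfl g3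
    obtain ⟨i4, i4'⟩ := hinner _ _ _ le_rfl g4
    obtain ⟨i5, i5'⟩ := hinner _ _ _ le_rfl g5
    obtain ⟨i6, i6'⟩ := hinner _ _ _ le_rfl g6
    obtain ⟨i7, i7'⟩ := hinner _ _ _ le_rfl g7
    have g2' := (hm.symm b a).trans g2
    -- a monochromatic path `x, y, z` is excluded if `y` has only one possible neighbour `p y` of
    -- its own colour
    have hpath : ∀ (f : V → ℤˣ) (p : V → V),
        (∀ x ∈ S, ∀ y ∈ S, 0 < m x y → f x = f y → x = p y) →
        ∀ x ∈ S, ∀ y ∈ S, ∀ z ∈ S, 0 < m x y → 0 < m y z → x ≠ z → f x = f y → f y ≠ f z :=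
      fun f p hp x hx y hy z hz hxy hyz hxz h1 h2 =>
        hxz ((hp x hx y hy hxy h1).trans (hp z hz y hy (hm.symm y z ▸ hyz) h2.symm).symm)
    rw [if_neg (by omega)]
    by_cases hSF : S ∈ F
    · rw [if_pos (Or.inr hSF), neg_one_mul] at hτ
      set f : V → ℤˣ := fun x => if x = a ∨ x = c then τ a else - τ a with hf
      have fa : f a = τ a := by simp [hf]
      have fb : f b = - τ a := by simp [hf, n1.symm, n4]
      have fc : f c = τ a := by simp [hf]
      have fd : f d = - τ a := by simp [hf, n3.symm, n6.symm]
      obtain ⟨p, pa, pb, pc, pd⟩ : ∃ p : V → V, p a = c ∧ p b = d ∧ p c = a ∧ p d = b :=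
        ⟨fun y => if y = a then c else if y = c then a else if y = b then d else b, by
          simp [n1.symm, n2.symm, n3.symm, n4, n5.symm, n6.symm]⟩
      refine ⟨f, ?_, hpath f p ?_, fun _ => ?_, ?_⟩
      · intro x hx hxp
        rcases (hmem x).1 hx with rfl | rfl | rfl | rfl
        exacts [fa, fb.trans hτ.symm, (p3 hxp).elim, (p4 hxp).elim]
      · intro x hx y hy hxy hxy'
        rw [hmem] at hx hy
        rcases hx with hx | hx | hx | hx <;> rcases hy with hy | hy | hy | hy <;>
          rw [hx, hy] at hxy hxy' <;> rw [hx, hy] <;>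
          first
          | exact (hm.ne hxy rfl).elim
          | exact pa.symm
          | exact pb.symm
          | exact pc.symm
          | exact pd.symm
          | exact ((hneg' (τ a)).1 (by simpa only [fa, fb, fc, fd] using hxy')).elim
          | exact ((hneg' (τ a)).2 (by simpa only [fa, fb, fc, fd] using hxy')).elim
      · rw [hsum, fa, fb, fc, fd]
        simp
      · simp only [hsum, fa, fb, fc, fd, if_pos hSF, hm.inner_self, i2, i2', i3, i3', i4, i4', i5,
          i5', i6, i6', i7, i7', hneg', if_true, if_false]
        rfl
    · have hc : ¬ (S.card = 2 ∨ S ∈ F) := by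
        rintro (h | h)
        · omega
        · exact hSF h
      rw [if_neg hc, one_mul] at hτ
      set f : V → ℤˣ := fun x => if x = a ∨ x = b then τ a else - τ a with hf
      have fa : f a = τ a := by simp [hf]
      have fb : f b = τ a := by simp [hf]
      have fc : f c = - τ a := by simp [hf, n2.symm, n4.symm]
      have fd : f d = - τ a := by simp [hf, n3.symm, n5.symm]
      obtain ⟨p, pc, pd⟩ : ∃ p : V → V, p c = d ∧ p d = c :=
        ⟨fun y => if y = c then d else c, by simp [n6.symm]⟩
      refine ⟨f, ?_, hpath f p ?_, fun _ => ?_, ?_⟩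
      · intro x hx hxp
        rcases (hmem x).1 hx with rfl | rfl | rfl | rfl
        exacts [fa, fb.trans hτ.symm, (p3 hxp).elim, (p4 hxp).elim]
      · intro x hx y hy hxy hxy'
        rw [hmem] at hx hy
        rcases hx with hx | hx | hx | hx <;> rcases hy with hy | hy | hy | hy <;>
          rw [hx, hy] at hxy hxy' <;> rw [hx, hy] <;>
          first
          | exact (hm.ne hxy rfl).elim
          | exact pc.symm
          | exact pd.symm
          | exact ((hneg' (τ a)).1 (by simpa only [fa, fb, fc, fd] using hxy')).elim
          | exact ((hneg' (τ a)).2 (by simpa only [fa, fb, fc, fd] using hxy')).elim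
          | omega
      · rw [hsum, fa, fb, fc, fd]
        simp
      · simp only [hsum, fa, fb, fc, fd, if_neg hSF, hm.inner_self, i2, i2', i3, i3', i4, i4', i5,
          i5', i6, i6', i7, i7', hneg', if_true, if_false]
        rfl

/-- The colouring obtained by gluing the colourings of the units. The set `F` consists of the
diamonds that get two monochromatic edges. -/
lemma exists_coloring_of_even {F : Finset (Finset V)} (hF : F ⊆ diamonds m)
    (heven : Even ((diamonds m).card + F.card)) : ∃ σ : V → ℤˣ,
      (∀ x y z, 0 < m x y → 0 < m y z → x ≠ z → σ x = σ y → σ y ≠ σ z) ∧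
      ∑ x, (σ x : ℤ) = 0 ∧
      monoSum m σ = 2 * ((triangles m).card + (diamonds m).card + F.card) := by
  classical
  obtain ⟨τ, h1, h2, h3, h4⟩ := hm.exists_port_coloring hF heven
  obtain ⟨g, hg⟩ : ∃ g : Finset V → V → ℤˣ, ∀ S ∈ units m,
      (∀ x ∈ S, x ∈ ports m → g S x = τ x) ∧
      (∀ x ∈ S, ∀ y ∈ S, ∀ z ∈ S, 0 < m x y → 0 < m y z → x ≠ z → g S x = g S y →
        g S y ≠ g S z) ∧
      (S ∉ triangles m → ∑ x ∈ S, (g S x : ℤ) = 0) ∧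
      ∑ x ∈ S, ∑ y ∈ S, (if g S x = g S y then inner m S x y else 0) =
        if S.card = 2 then 0 else if S ∈ F then 4 else 2 := by
    have : ∀ S, ∃ f : V → ℤˣ, S ∈ units m → _ := fun S =>
      if hS : S ∈ units m then
        let ⟨f, hf⟩ := hm.exists_unit_coloring hF h2 h3 hS
        ⟨f, fun _ => hf⟩
      else ⟨1, fun h => (hS h).elim⟩
    choose g hg using this
    exact ⟨g, hg⟩
  set σ : V → ℤˣ := fun x => g (unitOf m x) x with hσ
  have hσS : ∀ S ∈ units m, ∀ x ∈ S, σ x = g S x := by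
    intro S hS x hx
    simp only [hσ, hm.unitOf_eq hS hx]
  obtain ⟨e, he, hout⟩ := hm.exists_outer_matching
  have houter : ∀ x y, outer m x y ≠ 0 → σ x ≠ σ y := by
    have hport : ∀ x ∈ ports m, σ x = τ x := fun x hx =>
      (hg _ (hm.unitOf_mem x)).1 x (mem_unitOf x) hx
    intro x y hxy
    rw [hport x (hout x y hxy).1, hport y (hout y x (hm.outer_symm x y ▸ hxy)).1, h1 x y hxy]
    generalize τ x = u
    revert u
    decide
  have hmem : ∀ x y, 0 < m x y → σ x = σ y → y ∈ unitOf m x := by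
    intro x y hxy h
    by_contra hy
    refine houter x y ?_ h
    rw [outer, if_neg hy]
    omega
  have hmono : monoSum m σ = 2 * ((triangles m).card + (diamonds m).card + F.card) := by
    rw [← hm.monoSum_units, Finset.sum_congr rfl (g := fun S =>
      if S.card = 2 then 0 else if S ∈ F then 4 else 2), hm.sum_units_eq,
      Finset.sum_eq_zero (s := digons m) (fun S hS => if_pos (hm.card_digon hS)),
      Finset.sum_congr rfl (s₁ := triangles m) (g := fun _ => 2),
      Finset.sum_congr rfl (s₁ := diamonds m) (g := fun S => 2 + if S ∈ F then 2 else 0),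
      Finset.sum_add_distrib, Finset.sum_ite_mem, Finset.inter_eq_right.2 hF,
      Finset.sum_eq_zero (s := Finset.univ)]
    · simp only [Finset.sum_const, smul_eq_mul]
      ring
    · intro x _
      refine Finset.sum_eq_zero fun y _ => ?_
      by_contra h
      rw [ite_eq_right_iff, not_forall] at h
      obtain ⟨h, h'⟩ := h
      exact houter x y h' h
    · intro S hS
      have := hm.card_diamond hS
      rw [if_neg (by omega)]
      split_ifs <;> rfl
    · intro S hS
      have := hm.card_triangle hS
      rw [if_neg (by omega), if_neg]
      intro hSF
      have := hm.card_diamond (hF hSF)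
      omega
    · intro S hS
      rw [← (hg S hS).2.2.2]
      refine Finset.sum_congr rfl fun x hx => Finset.sum_congr rfl fun y hy => ?_
      rw [hσS S hS x hx, hσS S hS y hy]
  refine ⟨σ, ?_, ?_, hmono⟩
  · intro x y z hxy hyz hxz h5 h6
    have hU := hm.unitOf_mem y
    have hx := hmem y x (hm.symm x y ▸ hxy) h5.symm
    have hz := hmem y z hyz h6
    have hy := mem_unitOf (m := m) y
    rw [hσS _ hU x hx, hσS _ hU y hy] at h5
    rw [hσS _ hU y hy, hσS _ hU z hz] at h6
    exact (hg _ hU).2.1 x hx y hy z hz hxy hyz hxz h5 h6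
  · have hsum : ∑ x, (σ x : ℤ) = ∑ T ∈ triangles m, ∑ x ∈ T, (τ x : ℤ) := by
      have hzero : ∀ S ∈ units m, S ∉ triangles m → ∑ x ∈ S, (σ x : ℤ) = 0 := by
        intro S hS hT
        rw [← (hg S hS).2.2.1 hT]
        exact Finset.sum_congr rfl fun x hx => by rw [hσS S hS x hx]
      rw [← hm.sum_units, ← Finset.sum_subset (s₁ := triangles m)
        (fun S hS => mem_units.2 (Or.inr (Or.inl hS))) hzero]
      refine Finset.sum_congr rfl fun S hS => Finset.sum_congr rfl fun x hx => ?_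
      have hS' := mem_units.2 (Or.inr (Or.inl hS))
      rw [hσS S hS' x hx, (hg S hS').1 x hx (hm.triangle_subset_ports hS hx)]
    obtain ⟨p, q, hpq, hpq'⟩ := hm.exists_class_edges σ
    rw [← hsum, abs_le] at h4
    -- the number of monochromatic edges is even, so the sum of the colours is divisible by four
    obtain ⟨k, hk⟩ := heven
    obtain ⟨l, hl⟩ := hm.even_card_triangles
    rw [hmono] at hpq
    push_cast at hpq
    omega

/-- Some balanced colouring has the least possible number of monochromatic edges, which is the least
even number that is not less than the number of triangles and diamonds. -/
lemma exists_optimal_coloring : ∃ σ : V → ℤˣ,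
    (∀ x y z, 0 < m x y → 0 < m y z → x ≠ z → σ x = σ y → σ y ≠ σ z) ∧
    ∑ x, (σ x : ℤ) = 0 ∧
    monoSum m σ = 2 * ((triangles m).card + (diamonds m).card +
      if Even (diamonds m).card then 0 else 1) ∧
    ∀ σ' : V → ℤˣ, ∑ x, (σ' x : ℤ) = 0 → monoSum m σ ≤ monoSum m σ' := by
  classical
  obtain ⟨F, hF, hFc, heven⟩ : ∃ F ⊆ diamonds m,
      F.card = (if Even (diamonds m).card then 0 else 1) ∧ Even ((diamonds m).card + F.card) := by
    split_ifs with h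
    · exact ⟨∅, by simp, by simp, by simpa using h⟩
    · obtain ⟨D, hD⟩ : (diamonds m).Nonempty := by
        rw [Finset.nonempty_iff_ne_empty]
        rintro h'
        simp [h'] at h
      refine ⟨{D}, by simpa using hD, by simp, ?_⟩
      rw [Finset.card_singleton]
      exact (Nat.not_even_iff_odd.1 h).add_one
  obtain ⟨σ, h1, h2, h3⟩ := hm.exists_coloring_of_even hF heven
  refine ⟨σ, h1, h2, hFc ▸ h3, fun σ' hσ' => ?_⟩
  have hle := hm.le_monoSum σ'
  obtain ⟨p, q, hp, hq⟩ := hm.exists_class_edges σ'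
  obtain ⟨k, hk⟩ := heven
  obtain ⟨l, hl⟩ := hm.even_card_triangles
  have : F.card ≤ 1 := by
    rw [hFc]
    split_ifs <;> omega
  rw [hσ'] at hq
  omega

end IsCubicWeight

end MonoSum

/-! ### From multigraphs to multiplicity functions -/

section Translation

variable {α β : Type*}

/-- The number of edges between two vertices, as a natural number. -/
noncomputable def mult (G : Graph α β) (x y : V(G)) : ℕ := {e | G.IsLink e x y}.ncard

variable {G : Graph α β}

namespace IsCubic

variable (hcubic : G.IsCubic)
include hcubic

lemma finite_incidenceSet (x : V(G)) : (G.incidenceSet x).Finite :=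
  Set.finite_of_encard_eq_coe (k := 3) (hcubic x x.2)

lemma finite_links (x y : V(G)) : {e | G.IsLink e x y}.Finite :=
  (hcubic.finite_incidenceSet x).subset fun _ he => ⟨_, he⟩

lemma multiplicity_eq (x y : V(G)) : G.multiplicity x y = G.mult x y :=
  ((hcubic.finite_links x y).cast_ncard_eq).symm

lemma multiplicity_eq_zero_iff (x y : V(G)) : G.multiplicity x y = 0 ↔ G.mult x y = 0 := by
  rw [hcubic.multiplicity_eq]
  exact_mod_cast Iff.rfl

lemma multiplicity_eq_one_iff (x y : V(G)) : G.multiplicity x y = 1 ↔ G.mult x y = 1 := by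
  rw [hcubic.multiplicity_eq]
  exact_mod_cast Iff.rfl

lemma two_le_multiplicity_iff (x y : V(G)) : 2 ≤ G.multiplicity x y ↔ 2 ≤ G.mult x y := by
  rw [hcubic.multiplicity_eq]
  exact_mod_cast Iff.rfl

lemma mult_pos_iff (x y : V(G)) : 0 < G.mult x y ↔ G.Adj x y := by
  rw [mult, Set.ncard_pos (hcubic.finite_links x y)]
  exact Iff.rfl

lemma sum_mult [Fintype V(G)] (x : V(G)) : ∑ y, G.mult x y = 3 := by
  classical
  have h3 : (G.incidenceSet x).ncard = 3 := by
    rw [Set.ncard, hcubic x x.2]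
    rfl
  rw [← h3, Set.ncard_eq_toFinset_card _ (hcubic.finite_incidenceSet x),
    Finset.sum_congr rfl (f := G.mult x)
      (fun y _ => Set.ncard_eq_toFinset_card _ (hcubic.finite_links x y)),
    ← Finset.card_biUnion]
  · congr 1
    ext e
    simp only [Finset.mem_biUnion, Finset.mem_univ, true_and, Set.Finite.mem_toFinset]
    exact ⟨fun ⟨y, hy⟩ => ⟨y, hy⟩, fun ⟨y, hy⟩ => ⟨⟨y, hy.right_mem⟩, hy⟩⟩
  · intro y _ z _ hyz
    refine Finset.disjoint_left.2 fun e he he' => hyz ?_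
    simp only [Set.Finite.mem_toFinset] at he he'
    exact Subtype.ext (IsLink.right_unique he he')

end IsCubic

lemma mult_symm (x y : V(G)) : G.mult x y = G.mult y x := by
  rw [mult, mult]
  congr 1
  ext e
  exact isLink_comm

lemma mult_self (hloop : G.Loopless) (x : V(G)) : G.mult x x = 0 := by
  rw [mult, Set.eq_empty_of_forall_notMem (s := {e | G.IsLink e x x}) fun e he =>
    hloop.not_isLoopAt e x he, Set.ncard_empty]

lemma IsConnectedGraph.mem_of_closed (hcubic : G.IsCubic) (hconn : G.IsConnectedGraph)
    (Z : Finset V(G)) (hZ : Z.Nonempty) (hclosed : ∀ x ∈ Z, ∀ y, 0 < G.mult x y → y ∈ Z)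
    (x : V(G)) : x ∈ Z := by
  obtain ⟨z, hz⟩ := hZ
  have hreach := hconn.2 z z.2 x x.2
  suffices h : ∀ y, Relation.ReflTransGen G.Adj z y → ∃ hy : y ∈ V(G), (⟨y, hy⟩ : V(G)) ∈ Z by
    exact (h x hreach).2
  intro y hy
  induction hy with
  | refl => exact ⟨z.2, hz⟩
  | tail _ hadj ih =>
    obtain ⟨h1, h2⟩ := ih
    exact ⟨hadj.right_mem, hclosed _ h2 _ ((hcubic.mult_pos_iff _ _).2 hadj)⟩

lemma isCubicWeight_mult [Fintype V(G)] (hloop : G.Loopless) (hcubic : G.IsCubic)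
    (hconn : G.IsConnectedGraph) (hclaw : G.IsClawFree) (hK4 : ¬ G.IsK4) :
    IsCubicWeight G.mult where
  symm := mult_symm
  self := mult_self hloop
  sum := hcubic.sum_mult
  conn := hconn.mem_of_closed hcubic
  claw x a b c hab hac hbc ha hb hc := by
    by_contra! h
    obtain ⟨h1, h2, h3⟩ := h
    have hne : ∀ y, G.mult x y = 1 → x ≠ y := by
      rintro y hy rfl
      rw [mult_self hloop] at hy
      omega
    set f : Fin 1 ⊕ Fin 3 → V(G) := Sum.elim (fun _ => x) ![a, b, c] with hf
    refine hclaw _ ⟨?_, fun i => (f i : α), ?_, rfl, ?_⟩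
    · rintro _ ⟨i, rfl⟩
      exact (f i).2
    · refine Subtype.val_injective.comp ?_
      have n1 := hne a ha
      have n2 := hne b hb
      have n3 := hne c hc
      intro i j hij
      rcases i with i | i <;> rcases j with j | j <;> fin_cases i <;> fin_cases j <;>
        simp_all [eq_comm]
    · intro i j
      rw [hcubic.multiplicity_eq_one_iff, hcubic.multiplicity_eq_zero_iff]
      have s1 := mult_symm x a
      have s2 := mult_symm x b
      have s3 := mult_symm x c
      have s4 := mult_symm a b
      have s5 := mult_symm a c
      have s6 := mult_symm b c
      rcases i with i | i <;> rcases j with j | j <;> fin_cases i <;> fin_cases j <;>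
        simp [hf, mult_self hloop] <;> omega
  not_K4 a b c d hab hac had hbc hbd hcd hall := by
    have hne : ∀ x y, G.mult x y = 1 → x ≠ y := by
      rintro x y hy rfl
      rw [mult_self hloop] at hy
      omega
    set f : Fin 4 → V(G) := ![a, b, c, d] with hf
    refine hK4 ⟨subset_rfl, fun i => (f i : α), ?_, ?_, ?_⟩
    · refine Subtype.val_injective.comp ?_
      have n1 := hne a b hab
      have n2 := hne a c hac
      have n3 := hne a d had
      have n4 := hne b c hbc
      have n5 := hne b d hbd
      have n6 := hne c d hcd
      intro i j hij
      fin_cases i <;> fin_cases j <;> simp_all [eq_comm]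
    · ext v
      constructor
      · rintro ⟨i, rfl⟩
        exact (f i).2
      · intro hv
        rcases hall ⟨v, hv⟩ with h | h | h | h
        exacts [⟨0, by simp [hf, ← h]⟩, ⟨1, by simp [hf, ← h]⟩, ⟨2, by simp [hf, ← h]⟩,
          ⟨3, by simp [hf, ← h]⟩]
    · intro i j
      rw [hcubic.multiplicity_eq_one_iff, hcubic.multiplicity_eq_zero_iff]
      have s1 := mult_symm a b
      have s2 := mult_symm a c
      have s3 := mult_symm a d
      have s4 := mult_symm b c
      have s5 := mult_symm b d
      have s6 := mult_symm c d
      fin_cases i <;> fin_cases j <;> simp [hf, mult_self hloop] <;> omega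

/-- Families of sets of vertices can be counted in the finite subtype `V(G)`. -/
lemma ncard_eq_card_of_image (A : Finset (Finset V(G))) (P : Set α → Prop)
    (h1 : ∀ S ∈ A, P (Subtype.val '' (S : Set V(G))))
    (h2 : ∀ T, P T → ∃ S ∈ A, Subtype.val '' (S : Set V(G)) = T) :
    {T | P T}.ncard = A.card := by
  have : {T | P T} = (fun S : Finset V(G) => Subtype.val '' (S : Set V(G))) '' (A : Set _) := by
    ext T
    constructor
    · exact fun hT => h2 T hT
    · rintro ⟨S, hS, rfl⟩
      exact h1 S hS
  rw [this, Set.ncard_image_of_injective, Set.ncard_coe_finset]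
  exact (Subtype.val_injective.image_injective).comp Finset.coe_injective

lemma numDiamonds_eq [Fintype V(G)] (hloop : G.Loopless) (hcubic : G.IsCubic) :
    G.numDiamonds = (diamonds G.mult).card := by
  classical
  refine ncard_eq_card_of_image _ _ ?_ ?_
  · intro S hS
    obtain ⟨a, b, c, d, rfl, hab, hab0, hac, had, hbc, hbd, hcd⟩ := mem_diamonds.1 hS
    have hne : ∀ x y, G.mult x y = 1 → x ≠ y := by
      rintro x y hy rfl
      rw [mult_self hloop] at hy
      omega
    set f : Fin 4 → V(G) := ![a, b, c, d] with hf
    refine ⟨?_, fun i => (f i : α), ?_, ?_, ?_⟩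
    · rintro _ ⟨v, -, rfl⟩
      exact v.2
    · refine Subtype.val_injective.comp ?_
      have n2 := hne a c hac
      have n3 := hne a d had
      have n4 := hne b c hbc
      have n5 := hne b d hbd
      have n6 := hne c d hcd
      intro i j hij
      fin_cases i <;> fin_cases j <;> simp_all [eq_comm]
    · have : (fun i => (f i : α)) = Subtype.val ∘ f := rfl
      rw [this, Set.range_comp]
      congr 1
      ext v
      simp only [hf, Finset.coe_insert, Finset.coe_singleton, Set.mem_insert_iff,
        Set.mem_singleton_iff, Matrix.range_cons, Matrix.range_empty, Set.union_empty,
        Set.mem_union]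
    · intro i j
      rw [hcubic.multiplicity_eq_one_iff, hcubic.multiplicity_eq_zero_iff]
      have s1 := mult_symm a b
      have s2 := mult_symm a c
      have s3 := mult_symm a d
      have s4 := mult_symm b c
      have s5 := mult_symm b d
      have s6 := mult_symm c d
      fin_cases i <;> fin_cases j <;> simp [hf, mult_self hloop] <;> omega
  · rintro T ⟨hTV, f, hinj, rfl, hadj⟩
    have hV : ∀ i, f i ∈ V(G) := fun i => hTV ⟨i, rfl⟩
    set g : Fin 4 → V(G) := fun i => ⟨f i, hV i⟩ with hg
    have hadj' : ∀ i j, _ := fun i j => by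
      have := hadj i j
      rw [show f i = g i from rfl, show f j = g j from rfl, hcubic.multiplicity_eq_one_iff,
        hcubic.multiplicity_eq_zero_iff] at this
      exact this
    refine ⟨{g 0, g 1, g 2, g 3}, mem_diamonds.2 ⟨g 0, g 1, g 2, g 3, rfl, ?_, ?_, ?_, ?_, ?_, ?_,
      ?_⟩, ?_⟩
    · intro h
      have := hinj (congrArg Subtype.val h)
      simp at this
    · exact (hadj' 0 1).2 (by simp)
    · exact (hadj' 0 2).1 (by simp)
    · exact (hadj' 0 3).1 (by simp)
    · exact (hadj' 1 2).1 (by simp)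
    · exact (hadj' 1 3).1 (by simp)
    · exact (hadj' 2 3).1 (by simp)
    · ext v
      simp [hg, Fin.exists_fin_succ, eq_comm]

lemma numDigons_eq [Fintype V(G)] (hloop : G.Loopless) (hcubic : G.IsCubic) :
    G.numDigons = (digons G.mult).card := by
  classical
  have hmem : ∀ x y, 2 ≤ G.multiplicity x y → x ∈ V(G) ∧ y ∈ V(G) := by
    intro x y h
    have : {e | G.IsLink e x y}.Nonempty := by
      rw [← Set.encard_pos]
      exact lt_of_lt_of_le two_pos h
    obtain ⟨e, he⟩ := this
    exact ⟨he.left_mem, he.right_mem⟩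
  refine ncard_eq_card_of_image _ _ ?_ ?_
  · intro S hS
    obtain ⟨x, y, rfl, hxy, hno⟩ := mem_digons.1 hS
    have hne : x ≠ y := by
      rintro rfl
      rw [mult_self hloop] at hxy
      omega
    refine ⟨⟨x, y, fun h => hne (Subtype.ext h), by simp [Set.image_pair],
      (hcubic.two_le_multiplicity_iff x y).2 hxy⟩, ?_⟩
    rintro T ⟨u, v, w, huv, huw, hvw, rfl, h2, hauw, havw⟩ hsub
    have hauv : G.Adj u v := by
      obtain ⟨hu, hv⟩ := hmem u v h2
      refine (hcubic.mult_pos_iff ⟨u, hu⟩ ⟨v, hv⟩).1 ?_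
      have := (hcubic.two_le_multiplicity_iff ⟨u, hu⟩ ⟨v, hv⟩).1 h2
      omega
    -- the third vertex of the trumpet is a common neighbour
    have hno' : ∀ z, G.Adj x z → ¬ G.Adj y z := fun z hxz hyz =>
      hno ⟨z, hxz.right_mem⟩ ((hcubic.mult_pos_iff _ _).2 hxz) ((hcubic.mult_pos_iff _ _).2 hyz)
    have hx : (x : α) ∈ ({u, v, w} : Set α) := hsub ⟨x, by simp, rfl⟩
    have hy : (y : α) ∈ ({u, v, w} : Set α) := hsub ⟨y, by simp, rfl⟩
    have hne' : (x : α) ≠ y := fun h => hne (Subtype.ext h)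
    simp only [Set.mem_insert_iff, Set.mem_singleton_iff] at hx hy
    rcases hx with hx | hx | hx <;> rcases hy with hy | hy | hy <;> rw [hx, hy] at hno' hne'
    · exact hne' rfl
    · exact hno' w hauw havw
    · exact hno' v hauv havw.symm
    · exact hno' w havw hauw
    · exact hne' rfl
    · exact hno' u hauv.symm hauw.symm
    · exact hno' v havw.symm hauv
    · exact hno' u hauw.symm hauv.symm
    · exact hne' rfl
  · rintro T ⟨⟨x, y, hxy, rfl, h2⟩, htr⟩
    obtain ⟨hx, hy⟩ := hmem x y h2
    refine ⟨{⟨x, hx⟩, ⟨y, hy⟩}, mem_digons.2 ⟨_, _, rfl,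
      (hcubic.two_le_multiplicity_iff ⟨x, hx⟩ ⟨y, hy⟩).1 h2, ?_⟩, by simp [Set.image_pair]⟩
    intro z hxz hyz
    rw [hcubic.mult_pos_iff] at hxz hyz
    have := hloop
    refine htr {x, y, (z : α)} ⟨x, y, z, hxy, hxz.ne, hyz.ne, rfl, h2, hxz, hyz⟩ ?_
    intro v
    simp only [Set.mem_insert_iff, Set.mem_singleton_iff]
    tauto

/-- If no vertex of `B` has two neighbours in `B`, then the components of `G[B]` have at most two
vertices. -/
lemma encard_componentOf_le {B : Set α}
    (hB : ∀ x ∈ B, ∀ y ∈ B, ∀ z ∈ B, G.Adj x y → G.Adj y z → x = z) {x : α} (hx : x ∈ B) :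
    ((G.induce B).componentOf x).encard ≤ 2 := by
  have hadj : ∀ u v, (G.induce B).Adj u v → G.Adj u v ∧ u ∈ B ∧ v ∈ B := by
    rintro u v ⟨e, he⟩
    rw [induce_isLink] at he
    exact ⟨⟨e, he.1⟩, he.2⟩
  obtain ⟨y, hy⟩ : ∃ y, ∀ v, Relation.ReflTransGen (G.induce B).Adj x v → v = x ∨ v = y := by
    by_cases hex : ∃ y ∈ B, G.Adj x y
    · obtain ⟨y, hyB, hxy⟩ := hex
      refine ⟨y, fun v hv => ?_⟩
      induction hv with
      | refl => exact Or.inl rfl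
      | tail _ h ih =>
        obtain ⟨h1, h2, h3⟩ := hadj _ _ h
        rcases ih with rfl | rfl
        · exact Or.inr (hB _ h3 _ h2 _ hyB h1.symm hxy)
        · exact Or.inl (hB _ h3 _ h2 _ hx h1.symm hxy.symm)
    · refine ⟨x, fun v hv => ?_⟩
      induction hv with
      | refl => exact Or.inl rfl
      | tail _ h ih =>
        obtain ⟨h1, h2, h3⟩ := hadj _ _ h
        rw [or_self] at ih
        subst ih
        exact (hex ⟨_, h3, h1⟩).elim
  have hsub : (G.induce B).componentOf x ⊆ {x, y} := fun v hv => by simpa using hy v hv.2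
  exact (Set.encard_le_encard hsub).trans ((Set.encard_insert_le _ _).trans (by
    rw [Set.encard_singleton, one_add_one_eq_two]))

/-- Each monochromatic edge `e` is counted twice in `monoSum`, once for each order of its ends. -/
lemma two_mul_numMono [Fintype V(G)] (hloop : G.Loopless) (hcubic : G.IsCubic) {B W : Set α}
    {σ : V(G) → ℤˣ} (hB : ∀ x : V(G), (x : α) ∈ B ↔ σ x = 1)
    (hW : ∀ x : V(G), (x : α) ∈ W ↔ σ x = -1) : 2 * G.numMono B W = monoSum G.mult σ := by
  classical
  set E : Finset β := Finset.univ.biUnion fun x => (hcubic.finite_incidenceSet x).toFinset with hE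
  have hmemE : ∀ (e : β) (x y : V(G)), G.IsLink e x y → e ∈ E := by
    intro e x y h
    rw [hE, Finset.mem_biUnion]
    exact ⟨x, Finset.mem_univ _, (Set.Finite.mem_toFinset _).2 ⟨y, h⟩⟩
  have hsame : ∀ x y : V(G), (((x : α) ∈ B ∧ (y : α) ∈ B) ∨ ((x : α) ∈ W ∧ (y : α) ∈ W)) ↔
      σ x = σ y := by
    intro x y
    rw [hB, hB, hW, hW]
    rcases Int.units_eq_one_or (σ x) with h | h <;>
      rcases Int.units_eq_one_or (σ y) with h' | h' <;>
      rw [h, h'] <;> decide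
  have hmono : G.numMono B W =
      (E.filter fun e => ∃ x y : V(G), G.IsLink e x y ∧ σ x = σ y).card := by
    rw [numMono, ← Set.ncard_coe_finset]
    congr 1
    ext e
    simp only [Set.mem_ofPred_eq, Finset.coe_filter]
    constructor
    · rintro ⟨x, y, h, h'⟩
      have h2 := (hsame ⟨x, h.left_mem⟩ ⟨y, h.right_mem⟩).1 h'
      exact ⟨hmemE e ⟨x, h.left_mem⟩ ⟨y, h.right_mem⟩ h, _, _, h, h2⟩
    · rintro ⟨-, x, y, h, h'⟩
      exact ⟨x, y, h, (hsame x y).2 h'⟩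
  have hmult : ∀ x y : V(G), G.mult x y = ∑ e ∈ E, if G.IsLink e x y then 1 else 0 := by
    intro x y
    rw [← Finset.card_filter, mult, ← Set.ncard_coe_finset]
    congr 1
    ext e
    simp only [Set.mem_ofPred_eq, Finset.coe_filter]
    exact ⟨fun h => ⟨hmemE e x y h, h⟩, fun h => h.2⟩
  have hsum : monoSum G.mult σ =
      ∑ e ∈ E, ∑ p : V(G) × V(G), if σ p.1 = σ p.2 ∧ G.IsLink e p.1 p.2 then 1 else 0 := by
    rw [monoSum, ← Fintype.sum_prod_type' (f := fun x y => if σ x = σ y then G.mult x y else 0),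
      Finset.sum_comm]
    refine Finset.sum_congr rfl fun p _ => ?_
    rw [hmult]
    by_cases h : σ p.1 = σ p.2 <;> simp [h]
  rw [hsum, hmono, Finset.card_filter, Finset.mul_sum]
  refine Finset.sum_congr rfl fun e he => ?_
  rw [← Finset.card_filter]
  split_ifs with h
  · obtain ⟨x, y, hxy, hσ⟩ := h
    have hne : x ≠ y := fun h' => hxy.ne (congrArg Subtype.val h')
    rw [mul_one, ← Finset.card_pair (a := (x, y)) (b := (y, x)) (by
      intro h'
      exact hne (congrArg Prod.fst h'))]
    congr 1
    ext ⟨u, v⟩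
    simp only [Finset.mem_insert, Finset.mem_singleton, Finset.mem_filter, Finset.mem_univ,
      true_and, Prod.mk.injEq]
    constructor
    · rintro (⟨rfl, rfl⟩ | ⟨rfl, rfl⟩)
      · exact ⟨hσ, hxy⟩
      · exact ⟨hσ.symm, hxy.symm⟩
    · rintro ⟨-, h'⟩
      rcases hxy.eq_and_eq_or_eq_and_eq h' with ⟨h1, h2⟩ | ⟨h1, h2⟩
      · exact Or.inl ⟨Subtype.ext h1.symm, Subtype.ext h2.symm⟩
      · exact Or.inr ⟨Subtype.ext h2.symm, Subtype.ext h1.symm⟩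
  · rw [mul_zero, eq_comm, Finset.card_eq_zero, Finset.filter_eq_empty_iff]
    rintro ⟨u, v⟩ - ⟨h1, h2⟩
    exact h ⟨u, v, h2, h1⟩

/-- The colour classes have the same size if and only if the colours add up to zero. -/
lemma encard_eq_iff_sum_eq_zero [Fintype V(G)] {B W : Set α} (hBV : B ⊆ V(G)) (hWV : W ⊆ V(G))
    {σ : V(G) → ℤˣ} (hB : ∀ x : V(G), (x : α) ∈ B ↔ σ x = 1)
    (hW : ∀ x : V(G), (x : α) ∈ W ↔ σ x = -1) :
    B.encard = W.encard ↔ ∑ x, (σ x : ℤ) = 0 := by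
  classical
  have key : ∀ (A : Set α) (u : ℤˣ), A ⊆ V(G) → (∀ x : V(G), (x : α) ∈ A ↔ σ x = u) →
      A.encard = ((Finset.univ.filter fun x => σ x = u).card : ℕ∞) := by
    intro A u hAV hA
    rw [← Set.encard_coe_eq_coe_finsetCard, ← Subtype.val_injective.encard_image]
    congr 1
    ext v
    constructor
    · intro hv
      exact ⟨⟨v, hAV hv⟩, by simpa using (hA ⟨v, hAV hv⟩).1 hv, rfl⟩
    · rintro ⟨x, hx, rfl⟩
      exact (hA x).2 (by simpa using hx)
  rw [key B 1 hBV hB, key W (-1) hWV hW]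
  have hsum : ∑ x, (σ x : ℤ) = ((Finset.univ.filter fun x => σ x = 1).card : ℤ) -
      ((Finset.univ.filter fun x => σ x = -1).card : ℤ) := by
    rw [Finset.card_filter, Finset.card_filter, Nat.cast_sum, Nat.cast_sum,
      ← Finset.sum_sub_distrib]
    refine Finset.sum_congr rfl fun x _ => ?_
    rcases Int.units_eq_one_or (σ x) with h | h <;> rw [h] <;> decide
  rw [hsum, Nat.cast_inj]
  omega

end Translation

end Graph

theorem theorem3p1 {α β : Type*} (G : Graph α β) (hloop : G.Loopless) (hfin : V(G).Finite)
    (hcubic : G.IsCubic) (hconn : G.IsConnectedGraph) (hclaw : G.IsClawFree)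
    (hK4 : ¬ G.IsK4) :
    ∃ B W : Set α, G.IsKBisection 2 B W ∧
      (G.numMono B W : ℚ) =
        (if Even G.numDiamonds then
          ((V(G).ncard : ℚ) - G.numDiamonds - 2 * G.numDigons) / 3
        else
          ((V(G).ncard : ℚ) - G.numDiamonds - 2 * G.numDigons) / 3 + 1) ∧
      ∀ B' W' : Set α, G.IsKBisection 2 B' W' → G.numMono B W ≤ G.numMono B' W' := by
  classical
  have : Fintype V(G) := hfin.fintype
  have hm := Graph.isCubicWeight_mult hloop hcubic hconn hclaw hK4
  obtain ⟨σ, h1, h2, h3, h4⟩ := hm.exists_optimal_coloring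
  set B : Set α := {x | ∃ h : x ∈ V(G), σ ⟨x, h⟩ = 1} with hBdef
  set W : Set α := {x | ∃ h : x ∈ V(G), σ ⟨x, h⟩ = -1} with hWdef
  have hB : ∀ x : V(G), (x : α) ∈ B ↔ σ x = 1 := fun x => ⟨fun ⟨_, h⟩ => h, fun h => ⟨x.2, h⟩⟩
  have hW : ∀ x : V(G), (x : α) ∈ W ↔ σ x = -1 := fun x => ⟨fun ⟨_, h⟩ => h, fun h => ⟨x.2, h⟩⟩
  have hBV : B ⊆ V(G) := fun x ⟨h, _⟩ => h
  have hWV : W ⊆ V(G) := fun x ⟨h, _⟩ => h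
  have hcomp : ∀ (A : Set α) (u : ℤˣ), (∀ x ∈ A, ∃ h : x ∈ V(G), σ ⟨x, h⟩ = u) →
      ∀ x ∈ A, ((G.induce A).componentOf x).encard ≤ 2 := by
    intro A u hA x hx
    refine Graph.encard_componentOf_le ?_ hx
    intro x hx y hy z hz hxy hyz
    obtain ⟨hxV, hxu⟩ := hA x hx
    obtain ⟨hyV, hyu⟩ := hA y hy
    obtain ⟨hzV, hzu⟩ := hA z hz
    by_contra hne
    exact h1 ⟨x, hxV⟩ ⟨y, hyV⟩ ⟨z, hzV⟩ ((hcubic.mult_pos_iff _ _).2 hxy)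
      ((hcubic.mult_pos_iff _ _).2 hyz) (fun h => hne (congrArg Subtype.val h))
      (hxu.trans hyu.symm) (hyu.trans hzu.symm)
  have hmono := Graph.two_mul_numMono hloop hcubic hB hW
  refine ⟨B, W, ⟨⟨?_, ?_, ?_⟩, ?_, ?_⟩, ?_, ?_⟩
  · refine Set.Subset.antisymm (Set.union_subset hBV hWV) fun x hx => ?_
    rcases Int.units_eq_one_or (σ ⟨x, hx⟩) with h | h
    exacts [Or.inl ⟨hx, h⟩, Or.inr ⟨hx, h⟩]
  · refine Set.disjoint_left.2 ?_
    rintro x ⟨hx, h⟩ ⟨_, h'⟩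
    rw [h] at h'
    exact absurd h' (by decide)
  · exact (Graph.encard_eq_iff_sum_eq_zero hBV hWV hB hW).2 h2
  · exact hcomp B 1 fun x hx => hx
  · exact hcomp W (-1) fun x hx => hx
  · have hcard : V(G).ncard = Fintype.card V(G) := by
      rw [← Nat.card_coe_set_eq, Nat.card_eq_fintype_card]
    rw [hcard, hm.card_eq, Graph.numDiamonds_eq hloop hcubic, Graph.numDigons_eq hloop hcubic]
    rw [h3] at hmono
    have hmono' : G.numMono B W = (Graph.triangles G.mult).card + (Graph.diamonds G.mult).card +
        if Even (Graph.diamonds G.mult).card then 0 else 1 := by omega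
    rw [hmono']
    split_ifs <;> push_cast <;> ring
  · intro B' W' h'
    set σ' : V(G) → ℤˣ := fun x => if (x : α) ∈ B' then 1 else -1 with hσ'
    have hB' : ∀ x : V(G), (x : α) ∈ B' ↔ σ' x = 1 := by
      intro x
      by_cases hx : (x : α) ∈ B' <;> simp [hσ', hx]
    have hW' : ∀ x : V(G), (x : α) ∈ W' ↔ σ' x = -1 := by
      intro x
      have hx : (x : α) ∈ B' ∪ W' := h'.union_eq.symm ▸ x.2
      by_cases hxB : (x : α) ∈ B'
      · have := Set.disjoint_left.1 h'.disjoint hxB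
        simp [hσ', hxB, this]
      · simp [hσ', hxB, hx.resolve_left hxB]
    have hle := h4 σ' ((Graph.encard_eq_iff_sum_eq_zero
      (h'.union_eq ▸ Set.subset_union_left) (h'.union_eq ▸ Set.subset_union_right) hB' hW').1
      h'.encard_eq)
    have hmono' := Graph.two_mul_numMono hloop hcubic hB' hW'
    omega
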